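/- Let $\hat\Sigma$ be a simplicial complex on a set of vertices $X$, i.e. a family of finite subsets of $X$ that contains $\varnothing$ and is closed under taking subsets, with a weight $m:\hat\Sigma\to(0,\infty)$. Write $\tau\prec\sigma$ (or $\sigma\succ\tau$) if $\tau\subseteq\sigma$ and $|\sigma\setminus\tau|=1$. Put $\Sigma=\hat\Sigma$ if the total weight of the vertices is finite and $\Sigma=\hat\Sigma\setminus\{\varnothing\}$ otherwise, and assume $\sum_{\sigma\succ\tau}m(\sigma)<\infty$ for all $\tau\in\Sigma$. Let $C(\Sigma)$ be the space of complex functions on $\Sigma$, $C_c(\Sigma)$ the subspace of finitely supported ones, and $\ell^2=\ell^2(\Sigma,m)$ with $\|\omega\|^2=\sum_\Sigma m|\omega|^2$. Let $\delta:C(\Sigma)\to C(\Sigma)$ be a coboundary operator: a linear operator $\delta\omega(\sigma)=\sum_{\tau\prec\sigma}\theta(\tau,\sigma)\omega(\tau)$ with $\theta(\tau,\sigma)=\delta 1_\tau(\sigma)\in\{\pm1,0\}$, $\theta(\tau,\sigma)\neq0$ iff $\tau\prec\sigma$, and $\delta\delta=0$. Let $\partial\omega(\rho)=\frac1{m(\rho)}\sum_{\tau\succ\rho}m(\tau)\theta(\rho,\tau)\omega(\tau)$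 on $D(\partial)=\{\omega\in C(\Sigma):\sum_{\tau\succ\rho}m(\tau)|\omega(\tau)|<\infty\text{ for all }\rho\in\Sigma\}$. Define - $\delta_D$, the restriction of $\delta$ to the set of all $\omega\in\ell^2$ for which there are $\omega_n\in C_c(\Sigma)$ with $\|\omega_n-\omega\|^2+\|\delta(\omega_n-\omega)\|^2\to0$; - $\delta_N$, the restriction of $\delta$ to $\{\omega\in\ell^2:\delta\omega\in\ell^2\}$; - $\partial_N$, the restriction of $\partial$ to $\{\omega\in\ell^2\cap D(\partial):\partial\omega\in\ell^2\}$. An ideal boundary condition is an operator $\delta_I$ that is closed in $\ell^2$, satisfies $\delta_D\subseteq\delta_I\subseteq\delta_N$, and has $\mathrm{range}(\delta_I)\subseteq D(\delta_I)$. For $\rho\in\Sigma$ let $\mathrm{lk}(\rho)$ be the set of vertices $v\notin\rho$ with $\{v\}\cup\rho\in\Sigma$, and let $b_\rho$ be the weighted graph over $\mathrm{lk}(\rho)$ given by $b_\rho(v,v')=m(\{v,v'\}\cup\rho)$ if $v\ne v'$ and $\{v,v'\}\cup\rho\in\Sigma$, and $b_\rho(v,v')=0$ otherwise. A connected weighted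 graph $b$ is recurrent if the Markov chain with transition probabilities $b(x,y)/\sum_z b(x,z)$, started at any vertex $x$, almost surely visits every vertex $y$ at some time $k>0$; a graph with a single vertex counts as recurrent. **Theorem.** The following are equivalent: 1. $\delta_D$ is an ideal boundary condition; 2. $\partial\partial_N=0$, i.e. $\partial\partial\omega=0$ for all $\omega\in D(\partial_N)$. If, for all $\rho\in\Sigma$, all connected components of $b_\rho$ are recurrent, then $\delta_D$ is an ideal boundary condition. -/

import Mathlib

open scoped ENNReal
open MeasureTheory Filter Topology

noncomputable section

namespace BoundaryComplex

/-! ### Weighted simplicial complexes -/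

/-- `τ ≺ σ`: `τ` is a face of `σ` (of codimension one), `σ` is a coface of `τ`. -/
def IsFace {X : Type*} (τ σ : Finset X) : Prop := τ ⊆ σ ∧ σ.card = τ.card + 1

/-- Given a family `hat` of finite sets and weights `m`, this is `hat` itself if the total weight of
the vertices is finite, and `hat \ {∅}` otherwise. -/
def effective {X : Type*} (hat : Set (Finset X)) (m : Finset X → ℝ) : Set (Finset X) :=
  {σ | σ ∈ hat ∧ (σ = ∅ → Summable fun x : {x : X // {x} ∈ hat} => m {x.1})}

/-- A weighted simplicial complex on a set of vertices contained in `X`: a family of finite sets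
closed under subsets and containing `∅`, with positive locally summable weights. Only the values of
`m` on `hat` matter. -/
structure WeightedSimplicialComplex (X : Type*) where
  hat : Set (Finset X)
  empty_mem : ∅ ∈ hat
  down_closed : ∀ σ ∈ hat, ∀ τ ⊆ σ, τ ∈ hat
  m : Finset X → ℝ
  m_pos : ∀ σ ∈ hat, 0 < m σ
  locally_summable : ∀ τ ∈ effective hat m,
    Summable fun σ : {σ : Finset X // σ ∈ effective hat m ∧ IsFace τ σ} => m σ.1

namespace WeightedSimplicialComplex

variable {X : Type*}

/-- The set `Σ`, i.e. `hat` or `hat \ {∅}`. -/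
def simplices (K : WeightedSimplicialComplex X) : Set (Finset X) := effective K.hat K.m

/-- The type of elements of `Σ`. -/
abbrev Simplex (K : WeightedSimplicialComplex X) : Type _ := {σ : Finset X // σ ∈ K.simplices}

/-- The type of cofaces of `ρ` in `Σ`. -/
abbrev Coface (K : WeightedSimplicialComplex X) (ρ : K.Simplex) : Type _ :=
  {τ : K.Simplex // IsFace ρ.1 τ.1}

theorem weight_pos (K : WeightedSimplicialComplex X) (σ : K.Simplex) : 0 < K.m σ.1 :=
  K.m_pos _ σ.2.1

/-- The squared norm `∑ m |ω|²` of `ℓ²(Σ, m)`, with values in `[0, ∞]`. -/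
def normSq (K : WeightedSimplicialComplex X) (ω : K.Simplex → ℂ) : ℝ≥0∞ :=
  ∑' σ, ENNReal.ofReal (K.m σ.1 * ‖ω σ‖ ^ 2)

theorem normSq_add_le (K : WeightedSimplicialComplex X) (ω η : K.Simplex → ℂ) :
    K.normSq (ω + η) ≤ 2 * (K.normSq ω + K.normSq η) := by
  unfold normSq
  rw [← ENNReal.tsum_add, ← ENNReal.tsum_mul_left]
  refine ENNReal.tsum_le_tsum fun σ => ?_
  have hm := (K.weight_pos σ).le
  rw [← ENNReal.ofReal_add (by positivity) (by positivity), ← ENNReal.ofReal_ofNat 2,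
    ← ENNReal.ofReal_mul (by norm_num)]
  refine ENNReal.ofReal_le_ofReal ?_
  have h1 : ‖ω σ + η σ‖ ^ 2 ≤ 2 * (‖ω σ‖ ^ 2 + ‖η σ‖ ^ 2) := by
    have h2 := norm_add_le (ω σ) (η σ)
    nlinarith [norm_nonneg (ω σ + η σ), sq_nonneg (‖ω σ‖ - ‖η σ‖)]
  simp only [Pi.add_apply]
  nlinarith

theorem normSq_smul (K : WeightedSimplicialComplex X) (c : ℂ) (ω : K.Simplex → ℂ) :
    K.normSq (c • ω) = ENNReal.ofReal (‖c‖ ^ 2) * K.normSq ω := by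
  unfold normSq
  rw [← ENNReal.tsum_mul_left]
  refine tsum_congr fun σ => ?_
  rw [← ENNReal.ofReal_mul (by positivity)]
  congr 1
  simp only [Pi.smul_apply, smul_eq_mul, norm_mul]
  ring

/-- The space `ℓ²(Σ, m)`. -/
def l2 (K : WeightedSimplicialComplex X) : Submodule ℂ (K.Simplex → ℂ) where
  carrier := {ω | K.normSq ω < ∞}
  zero_mem' := by simp [normSq]
  add_mem' := fun {ω η} hω hη => lt_of_le_of_lt (K.normSq_add_le ω η)
    (ENNReal.mul_lt_top (by simp) (ENNReal.add_lt_top.2 ⟨hω, hη⟩))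
  smul_mem' := fun c ω hω => by
    simp only [Set.mem_ofPred_eq, normSq_smul] at hω ⊢
    exact ENNReal.mul_lt_top ENNReal.ofReal_lt_top hω

/-! ### Coboundary and boundary operators -/

variable [DecidableEq X]

/-- A coboundary operator. The field `op_apply` says that the operator acts by the (finite) sum
over the faces of a simplex with the coefficients `θ(τ, σ) = δ 1_τ (σ)`. -/
structure Coboundary (K : WeightedSimplicialComplex X) where
  op : (K.Simplex → ℂ) →ₗ[ℂ] (K.Simplex → ℂ)
  op_single : ∀ τ σ, op (Pi.single τ 1) σ = 1 ∨ op (Pi.single τ 1) σ = -1 ∨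
    op (Pi.single τ 1) σ = 0
  op_single_ne_zero_iff : ∀ τ σ, op (Pi.single τ 1) σ ≠ 0 ↔ IsFace τ.1 σ.1
  op_apply : ∀ ω σ, op ω σ =
    ∑ᶠ τ : {τ : K.Simplex // IsFace τ.1 σ.1}, op (Pi.single τ.1 1) σ * ω τ.1
  op_op : ∀ ω, op (op ω) = 0

namespace Coboundary

variable {K : WeightedSimplicialComplex X} (δ : K.Coboundary)

/-- The sign `θ(τ, σ) = δ 1_τ (σ)`. -/
def θ (τ σ : K.Simplex) : ℂ := δ.op (Pi.single τ 1) σ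

theorem norm_θ_le (τ σ : K.Simplex) : ‖δ.θ τ σ‖ ≤ 1 := by
  rcases δ.op_single τ σ with h | h | h <;> simp [θ, h]

theorem summable_boundary {ω : K.Simplex → ℂ} {ρ : K.Simplex}
    (h : Summable fun τ : K.Coface ρ => K.m τ.1.1 * ‖ω τ.1‖) :
    Summable fun τ : K.Coface ρ => (K.m τ.1.1 : ℂ) * δ.θ ρ τ.1 * ω τ.1 := by
  refine Summable.of_norm_bounded h fun τ => ?_
  have hm := (K.weight_pos τ.1).le
  rw [norm_mul, norm_mul, Complex.norm_real, Real.norm_of_nonneg hm]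
  have := mul_le_mul_of_nonneg_left (δ.norm_θ_le ρ τ.1) hm
  rw [mul_one] at this
  exact mul_le_mul_of_nonneg_right this (norm_nonneg _)

/-- The boundary operator `∂`, with domain
`D(∂) = {ω | ∑_{τ ≻ ρ} m(τ) |ω(τ)| < ∞ for all ρ}`. -/
def boundary : (K.Simplex → ℂ) →ₗ.[ℂ] (K.Simplex → ℂ) where
  domain :=
    { carrier := {ω | ∀ ρ : K.Simplex, Summable fun τ : K.Coface ρ => K.m τ.1.1 * ‖ω τ.1‖}
      zero_mem' := fun ρ => by simp
      add_mem' := fun {ω η} hω hη ρ => by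
        refine Summable.of_nonneg_of_le
          (fun τ => mul_nonneg (K.weight_pos τ.1).le (norm_nonneg _)) (fun τ => ?_)
          ((hω ρ).add (hη ρ))
        rw [← mul_add]
        exact mul_le_mul_of_nonneg_left (norm_add_le _ _) (K.weight_pos τ.1).le
      smul_mem' := fun c ω hω ρ => by
        refine ((hω ρ).mul_left ‖c‖).congr fun τ => ?_
        simp only [Pi.smul_apply, smul_eq_mul, norm_mul]
        ring }
  toFun :=
    { toFun := fun ω ρ =>
        1 / (K.m ρ.1 : ℂ) * ∑' τ : K.Coface ρ, (K.m τ.1.1 : ℂ) * δ.θ ρ τ.1 * ω.1 τ.1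
      map_add' := fun ω η => by
        funext ρ
        simp only [Pi.add_apply, Submodule.coe_add]
        rw [← mul_add, ← (δ.summable_boundary (ω.2 ρ)).tsum_add (δ.summable_boundary (η.2 ρ))]
        simp only [mul_add]
      map_smul' := fun c ω => by
        funext ρ
        simp only [Pi.smul_apply, Submodule.coe_smul, smul_eq_mul, RingHom.id_apply]
        have e : ∀ τ : K.Coface ρ, (K.m τ.1.1 : ℂ) * δ.θ ρ τ.1 * (c * ω.1 τ.1) =
            c * ((K.m τ.1.1 : ℂ) * δ.θ ρ τ.1 * ω.1 τ.1) := fun τ => by ring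
        simp only [e, tsum_mul_left]
        ring }

/-- The quadratic form `Q⁺(ω) = ∑ m |δω|²`. -/
def formUp (ω : K.Simplex → ℂ) : ℝ≥0∞ := K.normSq (δ.op ω)

/-- `D(Q⁺_D)`, the elements of `ℓ²` that are limits of finitely supported functions with respect to
the squared form norm `‖·‖² + Q⁺`. -/
def domainD : Submodule ℂ (K.Simplex → ℂ) where
  carrier := {ω | ω ∈ K.l2 ∧ ∃ u : ℕ → K.Simplex → ℂ, (∀ n, (Function.support (u n)).Finite) ∧
    Tendsto (fun n => K.normSq (u n - ω) + δ.formUp (u n - ω)) atTop (𝓝 0)}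
  zero_mem' := ⟨K.l2.zero_mem, fun _ => 0, by simp, by simp [formUp, normSq]⟩
  add_mem' := by
    rintro ω η ⟨hω, u, hu, hu'⟩ ⟨hη, v, hv, hv'⟩
    refine ⟨K.l2.add_mem hω hη, fun n => u n + v n,
      fun n => ((hu n).union (hv n)).subset (Function.support_add _ _), ?_⟩
    have hlim := ENNReal.Tendsto.const_mul (a := 2) (hu'.add hv') (Or.inr (by simp))
    rw [add_zero, mul_zero] at hlim
    refine tendsto_of_tendsto_of_tendsto_of_le_of_le tendsto_const_nhds hlim
      (fun _ => zero_le) fun n => ?_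
    have e : u n + v n - (ω + η) = (u n - ω) + (v n - η) := by abel
    simp only [formUp, e, map_add]
    refine (add_le_add (K.normSq_add_le _ _) (K.normSq_add_le _ _)).trans (le_of_eq ?_)
    ring
  smul_mem' := by
    rintro c ω ⟨hω, u, hu, hu'⟩
    refine ⟨K.l2.smul_mem c hω, fun n => c • u n,
      fun n => (hu n).subset (Function.support_const_smul_subset c _), ?_⟩
    have hlim := ENNReal.Tendsto.const_mul (a := ENNReal.ofReal (‖c‖ ^ 2)) hu' (Or.inr (by simp))
    rw [mul_zero] at hlim
    refine hlim.congr fun n => ?_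
    simp only [formUp, ← smul_sub, map_smul, normSq_smul, mul_add]

/-- `D(Q⁺_N)`, the elements of `ℓ²` with `Q⁺(ω) < ∞`. -/
def domainN : Submodule ℂ (K.Simplex → ℂ) := K.l2 ⊓ K.l2.comap δ.op

/-- `δ_D`, the coboundary operator with Dirichlet boundary conditions. -/
def opD : (K.Simplex → ℂ) →ₗ.[ℂ] (K.Simplex → ℂ) := δ.op.toPMap δ.domainD

/-- `δ_N`, the coboundary operator with Neumann boundary conditions. -/
def opN : (K.Simplex → ℂ) →ₗ.[ℂ] (K.Simplex → ℂ) := δ.op.toPMap δ.domainN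

/-- `D(Q⁻_N)`, the elements `ω` of `ℓ²` (and of `D(∂)`) with `Q⁻(ω) = ∑ m |∂ω|² < ∞`. -/
def boundaryDomainN : Submodule ℂ (K.Simplex → ℂ) where
  carrier := {ω | ω ∈ K.l2 ∧ ∃ h : ω ∈ δ.boundary.domain, K.normSq (δ.boundary ⟨ω, h⟩) < ∞}
  zero_mem' := ⟨K.l2.zero_mem, δ.boundary.domain.zero_mem, by
    have h : δ.boundary ⟨0, δ.boundary.domain.zero_mem⟩ = 0 := δ.boundary.map_zero
    rw [h]
    exact K.l2.zero_mem⟩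
  add_mem' := by
    rintro ω η ⟨hω, h, h'⟩ ⟨hη, k, k'⟩
    refine ⟨K.l2.add_mem hω hη, δ.boundary.domain.add_mem h k, ?_⟩
    have e := δ.boundary.map_add ⟨ω, h⟩ ⟨η, k⟩
    exact (congrArg (fun ζ => K.normSq ζ < ∞) e).mpr (K.l2.add_mem h' k')
  smul_mem' := by
    rintro c ω ⟨hω, h, h'⟩
    refine ⟨K.l2.smul_mem c hω, δ.boundary.domain.smul_mem c h, ?_⟩
    have e := δ.boundary.map_smul c ⟨ω, h⟩
    exact (congrArg (fun ζ => K.normSq ζ < ∞) e).mpr (K.l2.smul_mem c h')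

/-- `∂_N`, the boundary operator with Neumann boundary conditions. -/
def boundaryN : (K.Simplex → ℂ) →ₗ.[ℂ] (K.Simplex → ℂ) := δ.boundary.domRestrict δ.boundaryDomainN

/-- `∂∂_N = 0`: on all of `D(∂_N)` the composition `∂ ∂_N` is defined and vanishes. -/
def BoundaryBoundaryNEqZero : Prop :=
  ∀ ω : δ.boundaryN.domain, ∃ h : δ.boundaryN ω ∈ δ.boundary.domain,
    δ.boundary ⟨δ.boundaryN ω, h⟩ = 0

end Coboundary

/-- An operator acting in `ℓ²(Σ, m)` is closed: its graph is (sequentially) closed in `ℓ² × ℓ²`. -/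
def IsClosedOperator (K : WeightedSimplicialComplex X)
    (T : (K.Simplex → ℂ) →ₗ.[ℂ] (K.Simplex → ℂ)) : Prop :=
  ∀ (u : ℕ → T.domain) (ω η : K.Simplex → ℂ), ω ∈ K.l2 → η ∈ K.l2 →
    Tendsto (fun n => K.normSq (u n - ω)) atTop (𝓝 0) →
    Tendsto (fun n => K.normSq (T (u n) - η)) atTop (𝓝 0) →
    ∃ h : ω ∈ T.domain, T ⟨ω, h⟩ = η

/-- `T` is an ideal boundary condition: a closed operator with `δ_D ⊆ T ⊆ δ_N` and
`range T ⊆ D(T)`. -/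
structure Coboundary.IsIdealBoundaryCondition {K : WeightedSimplicialComplex X} (δ : K.Coboundary)
    (T : (K.Simplex → ℂ) →ₗ.[ℂ] (K.Simplex → ℂ)) : Prop where
  opD_le : δ.opD ≤ T
  le_opN : T ≤ δ.opN
  closed : K.IsClosedOperator T
  range_subset : ∀ ω : T.domain, T ω ∈ T.domain

end WeightedSimplicialComplex

/-! ### Weighted graphs and recurrence -/

/-- A weighted graph over `V`. -/
structure WeightedGraph (V : Type*) where
  b : V → V → ℝ
  nonneg : ∀ x y, 0 ≤ b x y
  symm : ∀ x y, b x y = b y x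
  diag : ∀ x, b x x = 0
  summable : ∀ x, Summable (b x)

namespace WeightedGraph

variable {V : Type*} (G : WeightedGraph V)

/-- The combinatorial graph: `x ∼ y` iff `b x y > 0`. -/
def toSimpleGraph : SimpleGraph V where
  Adj x y := 0 < G.b x y
  symm := ⟨fun x y h => by rwa [G.symm y x]⟩
  loopless := ⟨fun x h => by rw [G.diag x] at h; exact lt_irrefl _ h⟩

/-- Restriction of a weighted graph to a subset of the vertices. -/
def restrict (s : Set V) : WeightedGraph s where
  b x y := G.b x y
  nonneg x y := G.nonneg x y
  symm x y := G.symm x y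
  diag x := G.diag x
  summable x := (G.summable x).subtype s

open Classical in
/-- The transition probability `b(x, y) / ∑_z b(x, z)`. At a vertex without neighbours the walk
stays where it is (in a connected graph this only concerns the graph with a single vertex). -/
def transition (x y : V) : ℝ :=
  if ∑' z, G.b x z = 0 then (if x = y then 1 else 0) else G.b x y / ∑' z, G.b x z

/-- The space of trajectories in `V`, with the product σ-algebra of the discrete σ-algebra. -/
def Trajectory (V : Type*) : Type _ := ℕ → V

instance (V : Type*) : MeasurableSpace (Trajectory V) :=
  @MeasurableSpace.pi ℕ (fun _ => V) (fun _ => ⊤)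

open Classical in
/-- `P` is the law of the Markov chain `(Y_n)` with transition probabilities `G.transition`, started
at `Y_0 = x`. -/
def IsWalkLaw (x : V) (P : Measure (Trajectory V)) : Prop :=
  IsProbabilityMeasure P ∧ ∀ (n : ℕ) (a : ℕ → V),
    P {Y : Trajectory V | ∀ i ≤ n, Y i = a i} =
      if a 0 = x then ∏ i ∈ Finset.range n, ENNReal.ofReal (G.transition (a i) (a (i + 1))) else 0

/-- Recurrence of a connected weighted graph: started at any `x`, the walk almost surely visits
every `y` at some time `k > 0`. -/
def IsRecurrent : Prop :=
  ∀ x : V, ∃ P : Measure (Trajectory V), G.IsWalkLaw x P ∧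
    ∀ y : V, P {Y : Trajectory V | ∃ k > 0, Y k = y} = 1

/-- All connected components of the weighted graph are recurrent. -/
def AllComponentsRecurrent : Prop :=
  ∀ C : G.toSimpleGraph.ConnectedComponent, (G.restrict C.supp).IsRecurrent

end WeightedGraph

/-! ### Links -/

namespace WeightedSimplicialComplex

variable {X : Type*} [DecidableEq X]

/-- The link `lk(ρ)`: the vertices `v` for which `v ∪ ρ` is a coface of `ρ`. -/
abbrev Link (K : WeightedSimplicialComplex X) (ρ : K.Simplex) : Type _ :=
  {v : X // v ∉ ρ.1 ∧ insert v ρ.1 ∈ K.simplices}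

open Classical in
/-- The graph `b_ρ` on the link of `ρ`: `b_ρ(v, v') = m({v, v'} ∪ ρ)` if `v ≠ v'` and
`{v, v'} ∪ ρ` is a simplex, and `0` otherwise. -/
def linkGraph (K : WeightedSimplicialComplex X) (ρ : K.Simplex) : WeightedGraph (K.Link ρ) where
  b v w := if v ≠ w ∧ insert v.1 (insert w.1 ρ.1) ∈ K.simplices then
    K.m (insert v.1 (insert w.1 ρ.1)) else 0
  nonneg v w := by
    split_ifs with h
    · exact (K.m_pos _ h.2.1).le
    · exact le_rfl
  symm v w := by simp only [Finset.insert_comm v.1 w.1, ne_comm]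
  diag v := by simp
  summable v := by
    have hs := K.locally_summable _ v.2.2
    let s : Set (K.Link ρ) := {w | v ≠ w ∧ insert v.1 (insert w.1 ρ.1) ∈ K.simplices}
    have hw : ∀ w : s, w.1.1 ∉ insert v.1 ρ.1 := fun w => by
      simp only [Finset.mem_insert, not_or]
      exact ⟨fun h => w.2.1 (Subtype.ext h.symm), w.1.2.1⟩
    let f : s → {σ : Finset X // σ ∈ effective K.hat K.m ∧ IsFace (insert v.1 ρ.1) σ} := fun w =>
      ⟨insert w.1.1 (insert v.1 ρ.1), by rw [Finset.insert_comm]; exact w.2.2,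
        Finset.subset_insert _ _, Finset.card_insert_of_notMem (hw w)⟩
    have hf : Function.Injective f := fun w w' h => by
      have h1 : insert w.1.1 (insert v.1 ρ.1) = insert w'.1.1 (insert v.1 ρ.1) :=
        congrArg Subtype.val h
      have h2 : w.1.1 ∈ insert w'.1.1 (insert v.1 ρ.1) := h1 ▸ Finset.mem_insert_self _ _
      rcases Finset.mem_insert.1 h2 with h3 | h3
      · exact Subtype.ext (Subtype.ext h3)
      · exact absurd h3 (hw w)
    have h4 := summable_subtype_iff_indicator (f := fun w : K.Link ρ =>
      K.m (insert v.1 (insert w.1 ρ.1))) (s := s)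
    refine (h4.1 ((hs.comp_injective hf).congr fun w => ?_)).congr fun w => ?_
    · simp [f, Finset.insert_comm]
    · rw [Set.indicator_apply]
      rfl

end WeightedSimplicialComplex

end BoundaryComplex

end

noncomputable section

namespace BoundaryComplex

namespace WeightedSimplicialComplex

variable {X : Type*}

/-! ### The Hilbert space `ℓ²(Σ, m)` -/

/-! By definition the graph of `δ_D` is the closure, in `ℓ² × ℓ²`, of the graph of `δ` on finitely
supported functions. Testing against the functions `1_ρ` shows that the orthogonal complement of
that graph consists of the pairs `(-∂b, b)` with `b ∈ D(∂_N)` (`mem_coreGraph_orthogonal_iff`).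
Hence `ω ∈ D(δ_N)` lies in `D(δ_D)` iff `(ω, δω)` is orthogonal to all these pairs. As `δδω = 0`,
for `δω` this says `⟨δω, ∂b⟩ = 0` for all `b ∈ D(∂_N)`. Taking `ω = 1_ρ` turns the pairing into
`m(ρ) ∂∂b(ρ)`, so (1) gives (2). Conversely, if `∂∂b = 0` then `(0, ∂b)` is itself in the
complement, so `⟨δω, ∂b⟩ = 0` for every `ω ∈ D(δ_D)`.

For the recurrence criterion, `m(ρ) ∂∂b(ρ)` is an absolutely convergent sum over `lk(ρ)`, and it
suffices that the sum over each component vanishes (`tsum_component_eq_zero`). A recurrent component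
carries finitely supported `0 ≤ f_n ≤ 1` with `f_n → 1` and energy tending to `0`
(`exists_null_sequence`). With the signs `θ(ρ, ·)`, `f_n` becomes a function `φ_n` on cofaces of
`ρ`, and `δδ = 0` gives `|δφ_n| = |f_n(v) - f_n(w)|` on `ρ ∪ {v, w}`, so that `‖δφ_n‖² ≤` energy.
Now `⟨φ_n, ∂b⟩ = ⟨δφ_n, b⟩ → 0`, while the left side converges to the sum over the component.

The functions `f_n` are probabilities of hitting `o` before leaving a finite set. Their energy is `2
deg(o)` times the probability of not returning to `o` inside that set (`energy_add`), which is small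
by recurrence for large sets. -/

theorem normSq_lt_top_iff (K : WeightedSimplicialComplex X) (ω : K.Simplex → ℂ) :
    K.normSq ω < ∞ ↔ Summable fun σ => K.m σ.1 * ‖ω σ‖ ^ 2 := by
  have h0 : ∀ σ : K.Simplex, 0 ≤ K.m σ.1 * ‖ω σ‖ ^ 2 := fun σ =>
    mul_nonneg (K.weight_pos σ).le (sq_nonneg _)
  refine ⟨fun h => ?_, fun h => h.tsum_ofReal_lt_top⟩
  refine (ENNReal.summable_toReal h.ne).congr fun σ => ?_
  rw [ENNReal.toReal_ofReal (h0 σ)]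

theorem mem_l2_iff (K : WeightedSimplicialComplex X) (ω : K.Simplex → ℂ) :
    ω ∈ K.l2 ↔ Summable fun σ => K.m σ.1 * ‖ω σ‖ ^ 2 :=
  K.normSq_lt_top_iff ω

theorem norm_sqrt_mul_sq (K : WeightedSimplicialComplex X) (σ : K.Simplex) (z : ℂ) :
    ‖(√(K.m σ.1) : ℂ) * z‖ ^ 2 = K.m σ.1 * ‖z‖ ^ 2 := by
  rw [norm_mul, mul_pow, Complex.norm_real, Real.norm_of_nonneg (Real.sqrt_nonneg _),
    Real.sq_sqrt (K.weight_pos σ).le]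

/-- The Hilbert space of square summable functions on `Σ` with respect to the counting measure. -/
abbrev HilbertSpace (K : WeightedSimplicialComplex X) : Type _ := lp (fun _ : K.Simplex => ℂ) 2

/-- The isometry `ω ↦ √m ω` from `ℓ²(Σ, m)` to the unweighted space. -/
def toHilbert (K : WeightedSimplicialComplex X) : K.l2 →ₗ[ℂ] K.HilbertSpace where
  toFun ω := ⟨fun σ => (√(K.m σ.1) : ℂ) * ω.1 σ, by
    have h := (K.mem_l2_iff ω.1).1 ω.2
    refine (memℓp_gen_iff (by norm_num)).2 (h.congr fun σ => ?_)
    have := K.norm_sqrt_mul_sq σ (ω.1 σ)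
    simpa using this.symm⟩
  map_add' ω η := by
    ext σ
    exact mul_add _ _ _
  map_smul' c ω := by
    ext σ
    simp only [Submodule.coe_smul, Pi.smul_apply, smul_eq_mul, RingHom.id_apply, lp.coeFn_smul]
    ring

theorem toHilbert_apply (K : WeightedSimplicialComplex X) (ω : K.l2) (σ : K.Simplex) :
    K.toHilbert ω σ = (√(K.m σ.1) : ℂ) * ω.1 σ := rfl

theorem norm_toHilbert_sq (K : WeightedSimplicialComplex X) (ω : K.l2) :
    ENNReal.ofReal (‖K.toHilbert ω‖ ^ 2) = K.normSq ω.1 := by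
  have h := lp.norm_rpow_eq_tsum (p := 2) (by norm_num) (K.toHilbert ω)
  have h2 := (K.mem_l2_iff ω.1).1 ω.2
  simp only [ENNReal.toReal_ofNat, Real.rpow_ofNat, toHilbert_apply, norm_sqrt_mul_sq] at h
  rw [h, normSq, ENNReal.ofReal_tsum_of_nonneg
    (fun σ => mul_nonneg (K.weight_pos σ).le (sq_nonneg _)) h2]

theorem hasSum_inner_toHilbert (K : WeightedSimplicialComplex X) (ω η : K.l2) :
    HasSum (fun σ => (K.m σ.1 : ℂ) * (star (ω.1 σ) * η.1 σ))
      (inner ℂ (K.toHilbert ω) (K.toHilbert η)) := by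
  refine (lp.hasSum_inner (K.toHilbert ω) (K.toHilbert η)).congr_fun fun σ => ?_
  have h : (K.m σ.1 : ℂ) = √(K.m σ.1) * √(K.m σ.1) := by
    rw [← Complex.ofReal_mul, Real.mul_self_sqrt (K.weight_pos σ).le]
  rw [toHilbert_apply, toHilbert_apply, RCLike.inner_apply, h, map_mul, Complex.conj_ofReal,
    starRingEnd_apply]
  ring

theorem toHilbert_surjective (K : WeightedSimplicialComplex X) :
    Function.Surjective K.toHilbert := by
  intro e
  have hm : ∀ σ : K.Simplex, (√(K.m σ.1) : ℂ) * (e σ / (√(K.m σ.1) : ℂ)) = e σ := fun σ => by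
    have : (√(K.m σ.1) : ℂ) ≠ 0 := by
      exact_mod_cast (Real.sqrt_pos.2 (K.weight_pos σ)).ne'
    field_simp
  refine ⟨⟨fun σ => e σ / (√(K.m σ.1) : ℂ), (K.mem_l2_iff _).2 ?_⟩, ?_⟩
  · have h := (memℓp_gen_iff (p := 2) (by norm_num)).1 e.2
    refine h.congr fun σ => ?_
    rw [← K.norm_sqrt_mul_sq σ, hm]
    simp
  · ext σ
    exact hm σ

/-- The space of finitely supported functions. -/
def finSupp (K : WeightedSimplicialComplex X) : Submodule ℂ (K.Simplex → ℂ) where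
  carrier := {φ | φ.support.Finite}
  zero_mem' := by simp
  add_mem' := fun ha hb => (ha.union hb).subset (Function.support_add _ _)
  smul_mem' := fun c _ ha => ha.subset (Function.support_const_smul_subset c _)

theorem summable_coface_weight (K : WeightedSimplicialComplex X) (ρ : K.Simplex) :
    Summable fun τ : K.Coface ρ => K.m τ.1.1 := by
  have h := K.locally_summable ρ.1 ρ.2
  refine h.comp_injective (i := fun τ : K.Coface ρ => ⟨τ.1.1, τ.1.2, τ.2⟩) fun τ τ' e => ?_
  exact Subtype.ext (Subtype.ext (Subtype.mk.inj e))

/-- Follows from `|ω| ≤ 1 + |ω|²` and local summability of the weights. It makes `ℓ²` a subspace of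
`D(∂)`. -/
theorem summable_coface_mul_norm (K : WeightedSimplicialComplex X) {ω : K.Simplex → ℂ}
    (hω : ω ∈ K.l2) (ρ : K.Simplex) :
    Summable fun τ : K.Coface ρ => K.m τ.1.1 * ‖ω τ.1‖ := by
  refine Summable.of_nonneg_of_le
    (fun τ => mul_nonneg (K.weight_pos τ.1).le (norm_nonneg _)) (fun τ => ?_)
    ((K.summable_coface_weight ρ).add
      (((K.mem_l2_iff ω).1 hω).comp_injective (Subtype.val_injective (p := fun τ : K.Simplex =>
        IsFace ρ.1 τ.1))))
  have h := K.weight_pos τ.1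
  simp only [Function.comp]
  nlinarith [sq_nonneg (‖ω τ.1‖ - 1), norm_nonneg (ω τ.1)]

theorem finSupp_le_l2 (K : WeightedSimplicialComplex X) : K.finSupp ≤ K.l2 := fun φ hφ => by
  refine (K.mem_l2_iff φ).2 (summable_of_hasFiniteSupport (hφ.subset fun σ h => ?_))
  contrapose! h
  simp only [Function.mem_support, not_not] at h
  simp [h]

theorem tendsto_apply_of_normSq {K : WeightedSimplicialComplex X} {u : ℕ → K.Simplex → ℂ}
    {ω : K.Simplex → ℂ} (h : Tendsto (fun n => K.normSq (u n - ω)) atTop (𝓝 0)) (σ : K.Simplex) :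
    Tendsto (fun n => u n σ) atTop (𝓝 (ω σ)) := by
  have h1 : Tendsto (fun n => ENNReal.ofReal (K.m σ.1 * ‖u n σ - ω σ‖ ^ 2)) atTop (𝓝 0) :=
    tendsto_of_tendsto_of_tendsto_of_le_of_le tendsto_const_nhds h (fun _ => zero_le)
      fun n => ENNReal.le_tsum (f := fun σ => ENNReal.ofReal (K.m σ.1 * ‖(u n - ω) σ‖ ^ 2)) σ
  have h2 := (ENNReal.tendsto_toReal (by simp)).comp h1
  have hm := K.weight_pos σ
  have h3 := (h2.div_const (K.m σ.1)).sqrt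
  rw [tendsto_iff_norm_sub_tendsto_zero]
  refine (h3.congr fun n => ?_).trans (by simp)
  simp only [Function.comp]
  rw [ENNReal.toReal_ofReal (by positivity), mul_div_cancel_left₀ _ hm.ne',
    Real.sqrt_sq (norm_nonneg _)]

instance finite_faces {K : WeightedSimplicialComplex X} (σ : K.Simplex) :
    Finite {τ : K.Simplex // IsFace τ.1 σ.1} := by
  refine Finite.of_injective (β := σ.1.powerset)
    (fun τ => ⟨τ.1.1, Finset.mem_powerset.2 τ.2.1⟩) fun τ τ' h => ?_
  exact Subtype.ext (Subtype.ext (Subtype.mk.inj h))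

variable [DecidableEq X] {K : WeightedSimplicialComplex X}

theorem finSupp_le_span : K.finSupp ≤
    Submodule.span ℂ (Set.range fun τ : K.Simplex => (Pi.single τ 1 : K.Simplex → ℂ)) := by
  intro φ hφ
  have h : φ = ∑ τ ∈ hφ.toFinset, φ τ • (Pi.single τ 1 : K.Simplex → ℂ) := by
    funext σ
    simp only [Finset.sum_apply, Pi.smul_apply, smul_eq_mul, Pi.single_apply]
    simp only [mul_ite, mul_one, mul_zero, Finset.sum_ite_eq]
    by_cases hs : φ σ = 0
    · simp [hs]
    · rw [if_pos (hφ.mem_toFinset.2 hs)]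
  rw [h]
  exact Submodule.sum_mem _ fun τ _ =>
    Submodule.smul_mem _ _ (Submodule.subset_span ⟨τ, rfl⟩)

theorem single_mem_finSupp (τ : K.Simplex) : (Pi.single τ 1 : K.Simplex → ℂ) ∈ K.finSupp :=
  (Set.finite_singleton τ).subset Pi.support_single_subset

/-! ### Signs and the action on finitely supported functions -/

namespace Coboundary

variable (δ : K.Coboundary)

theorem l2_le_boundary_domain : K.l2 ≤ δ.boundary.domain :=
  fun _ hω ρ => K.summable_coface_mul_norm hω ρ

theorem θ_eq_zero {τ σ : K.Simplex} (h : ¬ IsFace τ.1 σ.1) : δ.θ τ σ = 0 := by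
  by_contra h'
  exact h ((δ.op_single_ne_zero_iff τ σ).1 h')

theorem θ_mul_self {τ σ : K.Simplex} (h : IsFace τ.1 σ.1) : δ.θ τ σ * δ.θ τ σ = 1 := by
  have h' := (δ.op_single_ne_zero_iff τ σ).2 h
  rcases δ.op_single τ σ with h1 | h1 | h1
  · simp [θ, h1]
  · simp [θ, h1]
  · exact absurd h1 h'

theorem star_θ (τ σ : K.Simplex) : star (δ.θ τ σ) = δ.θ τ σ := by
  rcases δ.op_single τ σ with h | h | h <;> simp [θ, h]

theorem hasSum_boundary {ω : K.Simplex → ℂ} (h : ω ∈ δ.boundary.domain) (ρ : K.Simplex) :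
    HasSum (fun σ => (K.m σ.1 : ℂ) * (δ.θ ρ σ * ω σ)) (K.m ρ.1 * δ.boundary ⟨ω, h⟩ ρ) := by
  have h1 := (δ.summable_boundary (h ρ)).hasSum
  have h2 : (K.m ρ.1 : ℂ) * δ.boundary ⟨ω, h⟩ ρ =
      ∑' τ : K.Coface ρ, (K.m τ.1.1 : ℂ) * δ.θ ρ τ.1 * ω τ.1 := by
    have : (K.m ρ.1 : ℂ) ≠ 0 := by exact_mod_cast (K.weight_pos ρ).ne'
    change (K.m ρ.1 : ℂ) * (1 / (K.m ρ.1 : ℂ) * _) = _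
    field_simp
  rw [h2]
  refine (Function.Injective.hasSum_iff (Subtype.val_injective
    (p := fun τ : K.Simplex => IsFace ρ.1 τ.1)) fun σ hσ => ?_).1
    (h1.congr_fun fun τ => ?_)
  · rw [δ.θ_eq_zero fun hf => hσ ⟨⟨σ, hf⟩, rfl⟩]
    simp
  · simp [mul_assoc]

/-- The squared norm is at most the total weight of the cofaces of `τ`, finite by local summability.
-/
theorem op_single_mem_l2 (τ : K.Simplex) : δ.op (Pi.single τ 1) ∈ K.l2 := by
  refine (K.mem_l2_iff _).2 ?_
  refine (Function.Injective.summable_iff (Subtype.val_injective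
    (p := fun σ : K.Simplex => IsFace τ.1 σ.1)) fun σ hσ => ?_).1 ?_
  · have := δ.θ_eq_zero (τ := τ) (σ := σ) fun hf => hσ ⟨⟨σ, hf⟩, rfl⟩
    simp only [θ] at this
    simp [this]
  · refine Summable.of_nonneg_of_le
      (fun σ => mul_nonneg (K.weight_pos σ.1).le (sq_nonneg _)) (fun σ => ?_)
      (K.summable_coface_weight τ)
    have h1 := δ.norm_θ_le τ σ.1
    have h2 := (K.weight_pos σ.1).le
    simp only [θ] at h1
    exact mul_le_of_le_one_right h2 (pow_le_one₀ (norm_nonneg _) h1)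

theorem finSupp_le_domainN : K.finSupp ≤ δ.domainN := by
  refine le_inf K.finSupp_le_l2 (finSupp_le_span.trans (Submodule.span_le.2 ?_))
  rintro _ ⟨τ, rfl⟩
  exact δ.op_single_mem_l2 τ

/-! ### The graph of `δ_N` in the Hilbert space -/

/-- The map `ω ↦ (ω, δω)`. -/
def graphMap : δ.domainN →ₗ[ℂ] WithLp 2 (K.HilbertSpace × K.HilbertSpace) :=
  (WithLp.linearEquiv 2 ℂ (K.HilbertSpace × K.HilbertSpace)).symm.toLinearMap ∘ₗ
    LinearMap.prod
      (K.toHilbert ∘ₗ Submodule.inclusion inf_le_left)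
      (K.toHilbert ∘ₗ δ.op.restrict (p := δ.domainN) (q := K.l2) fun _ h => h.2)

theorem graphMap_fst (ω : δ.domainN) :
    (δ.graphMap ω).fst = K.toHilbert ⟨ω.1, ω.2.1⟩ := rfl

theorem graphMap_snd (ω : δ.domainN) :
    (δ.graphMap ω).snd = K.toHilbert ⟨δ.op ω.1, ω.2.2⟩ := rfl

theorem norm_graphMap_sq (ω : δ.domainN) :
    ENNReal.ofReal (‖δ.graphMap ω‖ ^ 2) = K.normSq ω.1 + δ.formUp ω.1 := by
  rw [WithLp.prod_norm_sq_eq_of_L2, ENNReal.ofReal_add (sq_nonneg _) (sq_nonneg _),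
    graphMap_fst, graphMap_snd, norm_toHilbert_sq, norm_toHilbert_sq]
  rfl

/-- The graph of the restriction of `δ` to the finitely supported functions. -/
def coreGraph : Submodule ℂ (WithLp 2 (K.HilbertSpace × K.HilbertSpace)) :=
  (K.finSupp.comap δ.domainN.subtype).map δ.graphMap

theorem tendsto_graphMap_iff (u : ℕ → δ.domainN) (ω : δ.domainN) :
    Tendsto (fun n => δ.graphMap (u n)) atTop (𝓝 (δ.graphMap ω)) ↔
      Tendsto (fun n => K.normSq ((u n).1 - ω.1) + δ.formUp ((u n).1 - ω.1)) atTop (𝓝 0) := by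
  have e : ∀ n, K.normSq ((u n).1 - ω.1) + δ.formUp ((u n).1 - ω.1) =
      ENNReal.ofReal (‖δ.graphMap (u n) - δ.graphMap ω‖ ^ 2) := fun n => by
    rw [← map_sub, norm_graphMap_sq]
    rfl
  simp only [e]
  rw [tendsto_iff_norm_sub_tendsto_zero]
  constructor
  · intro h
    have := ENNReal.tendsto_ofReal (h.pow 2)
    simpa using this
  · intro h
    have h1 := (ENNReal.tendsto_toReal (by simp)).comp h
    have h2 := h1.sqrt
    refine (h2.congr fun n => ?_).trans (by simp)
    simp

/-- Write `δω = δu_n - δ(u_n - ω)` for a single `n` at which the form norm of the error is finite.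
-/
theorem domainD_le_domainN : δ.domainD ≤ δ.domainN := by
  rintro ω ⟨hω, u, hu, hu'⟩
  refine ⟨hω, ?_⟩
  obtain ⟨n, hn⟩ := (hu'.eventually (gt_mem_nhds ENNReal.zero_lt_top)).exists
  have h1 : δ.op (u n - ω) ∈ K.l2 := lt_of_le_of_lt le_add_self hn
  have h2 : δ.op (u n) ∈ K.l2 := (δ.finSupp_le_domainN (hu n)).2
  have h3 := K.l2.sub_mem h2 h1
  simpa [map_sub] using h3

theorem mem_domainD_iff (ω : δ.domainN) :
    ω.1 ∈ δ.domainD ↔ δ.graphMap ω ∈ δ.coreGraph.topologicalClosure := by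
  rw [← SetLike.mem_coe, ← SetLike.mem_coe, Submodule.topologicalClosure_coe,
    mem_closure_iff_seq_limit]
  constructor
  · rintro ⟨-, u, hu, hu'⟩
    let v : ℕ → δ.domainN := fun n => ⟨u n, δ.finSupp_le_domainN (hu n)⟩
    exact ⟨fun n => δ.graphMap (v n), fun n => ⟨v n, hu n, rfl⟩,
      (δ.tendsto_graphMap_iff v ω).2 hu'⟩
  · rintro ⟨y, hy, hy'⟩
    choose v hv hv' using hy
    refine ⟨ω.2.1, fun n => (v n).1, hv, (δ.tendsto_graphMap_iff v ω).1 ?_⟩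
    simpa only [hv'] using hy'

/-- Trades approximation by finitely supported functions for testing against the orthogonal
complement, which is explicit. -/
theorem mem_domainD_iff_orthogonal (ω : δ.domainN) :
    ω.1 ∈ δ.domainD ↔ δ.graphMap ω ∈ δ.coreGraphᗮᗮ := by
  rw [mem_domainD_iff, Submodule.orthogonal_orthogonal_eq_closure]

theorem inner_graphMap (ω : δ.domainN) (a b : K.l2) :
    inner ℂ (δ.graphMap ω) (WithLp.toLp 2 (K.toHilbert a, K.toHilbert b)) =
      inner ℂ (K.toHilbert ⟨ω.1, ω.2.1⟩) (K.toHilbert a) +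
      inner ℂ (K.toHilbert ⟨δ.op ω.1, ω.2.2⟩) (K.toHilbert b) := by
  rw [WithLp.prod_inner_apply]
  rfl

theorem inner_single (ρ : K.Simplex) (h : (Pi.single ρ 1 : K.Simplex → ℂ) ∈ K.l2) (a : K.l2) :
    inner ℂ (K.toHilbert ⟨Pi.single ρ 1, h⟩) (K.toHilbert a) = K.m ρ.1 * a.1 ρ := by
  refine (K.hasSum_inner_toHilbert ⟨Pi.single ρ 1, h⟩ a).unique ?_
  convert hasSum_single ρ _ using 1
  · simp
  · intro σ hσ
    simp [hσ]

/-- `∂` is the formal adjoint of `δ`: pairing with `δ 1_ρ` reads off the value of `∂` at `ρ`. -/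
theorem inner_op_single (ρ : K.Simplex) (b : K.l2) :
    inner ℂ (K.toHilbert ⟨δ.op (Pi.single ρ 1), δ.op_single_mem_l2 ρ⟩) (K.toHilbert b) =
      K.m ρ.1 * δ.boundary ⟨b.1, δ.l2_le_boundary_domain b.2⟩ ρ := by
  refine (K.hasSum_inner_toHilbert ⟨_, δ.op_single_mem_l2 ρ⟩ b).unique ?_
  refine (δ.hasSum_boundary (δ.l2_le_boundary_domain b.2) ρ).congr_fun fun σ => ?_
  have := δ.star_θ ρ σ
  simp only [θ] at this ⊢
  rw [this]

/-- The orthogonal complement of the graph of the restriction of `δ` to the finitely supported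
functions is, up to a rotation, the graph of `∂_N`. -/
theorem mem_coreGraph_orthogonal_iff (a b : K.l2) :
    WithLp.toLp 2 (K.toHilbert a, K.toHilbert b) ∈ δ.coreGraphᗮ ↔
      a.1 = - δ.boundary ⟨b.1, δ.l2_le_boundary_domain b.2⟩ := by
  have hs : ∀ ρ : K.Simplex, inner ℂ
      (δ.graphMap ⟨Pi.single ρ 1, δ.finSupp_le_domainN (single_mem_finSupp ρ)⟩)
      (WithLp.toLp 2 (K.toHilbert a, K.toHilbert b)) =
      K.m ρ.1 * (a.1 ρ + δ.boundary ⟨b.1, δ.l2_le_boundary_domain b.2⟩ ρ) := fun ρ => by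
    rw [inner_graphMap, inner_single, inner_op_single, mul_add]
  constructor
  · intro h
    funext ρ
    have h1 := hs ρ
    rw [(Submodule.mem_orthogonal _ _).1 h _ ⟨_, single_mem_finSupp ρ, rfl⟩] at h1
    have : (K.m ρ.1 : ℂ) ≠ 0 := by exact_mod_cast (K.weight_pos ρ).ne'
    exact eq_neg_of_add_eq_zero_left ((mul_eq_zero.1 h1.symm).resolve_left this)
  · intro h
    -- The indicator functions span, so orthogonality need only be tested on them.
    have hle : K.finSupp.comap δ.domainN.subtype ≤ Submodule.span ℂ (Set.range fun ρ : K.Simplex =>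
        (⟨Pi.single ρ 1, δ.finSupp_le_domainN (single_mem_finSupp ρ)⟩ : δ.domainN)) := by
      rw [← Submodule.map_le_map_iff_of_injective δ.domainN.injective_subtype,
        Submodule.map_span, ← Set.range_comp]
      exact (Submodule.map_comap_le _ _).trans finSupp_le_span
    refine (Submodule.mem_orthogonal _ _).2 ?_
    rintro _ ⟨φ, hφ, rfl⟩
    refine Submodule.span_induction (p := fun φ _ => inner ℂ (δ.graphMap φ)
      (WithLp.toLp 2 (K.toHilbert a, K.toHilbert b)) = 0) ?_ ?_ ?_ ?_ (hle hφ)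
    · rintro _ ⟨ρ, rfl⟩
      rw [hs, h]
      simp
    · simp
    · intro x y _ _ hx hy
      rw [map_add, inner_add_left, hx, hy, add_zero]
    · intro c x _ hx
      rw [map_smul, inner_smul_left, hx, mul_zero]

/-! ### Closedness of `δ_D` and the equivalence -/

theorem opD_le_opN : δ.opD ≤ δ.opN :=
  ⟨δ.domainD_le_domainN, fun x y h => by
    change δ.op x.1 = δ.op y.1
    rw [h]⟩

theorem tendsto_op_apply {u : ℕ → K.Simplex → ℂ} {ω : K.Simplex → ℂ}
    (h : ∀ σ, Tendsto (fun n => u n σ) atTop (𝓝 (ω σ))) (σ : K.Simplex) :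
    Tendsto (fun n => δ.op (u n) σ) atTop (𝓝 (δ.op ω σ)) := by
  have := Fintype.ofFinite {τ : K.Simplex // IsFace τ.1 σ.1}
  rw [δ.op_apply ω]
  refine Tendsto.congr (fun n => (δ.op_apply (u n) σ).symm) ?_
  simp only [finsum_eq_sum_of_fintype]
  exact tendsto_finsetSum _ fun τ _ => (h τ.1).const_mul _

/-- Every simplex has finitely many faces, so `δ` respects pointwise limits and `η = δω`. The pair
`(ω, δω)` is then a limit of points of a closed graph. -/
theorem isClosedOperator_opD : K.IsClosedOperator δ.opD := by
  intro u ω η hω hη h1 h2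
  have hop : δ.op ω = η := funext fun σ => tendsto_nhds_unique
    (δ.tendsto_op_apply (tendsto_apply_of_normSq h1) σ) (tendsto_apply_of_normSq h2 σ)
  subst hop
  let ω' : δ.domainN := ⟨ω, hω, hη⟩
  let v : ℕ → δ.domainN := fun n => ⟨(u n).1, δ.domainD_le_domainN (u n).2⟩
  refine ⟨(δ.mem_domainD_iff ω').2 ?_, rfl⟩
  refine (Submodule.isClosed_topologicalClosure _).mem_of_tendsto
    ((δ.tendsto_graphMap_iff v ω').2 ?_)
    (Eventually.of_forall fun n => (δ.mem_domainD_iff (v n)).1 (u n).2)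
  have h3 := h1.add h2
  rw [add_zero] at h3
  refine h3.congr fun n => ?_
  congr 1
  simp only [formUp, map_sub]
  rfl

theorem isIdealBoundaryCondition_opD_iff_range :
    δ.IsIdealBoundaryCondition δ.opD ↔ ∀ ω ∈ δ.domainD, δ.op ω ∈ δ.domainD :=
  ⟨fun h ω hω => h.range_subset ⟨ω, hω⟩, fun h =>
    ⟨le_rfl, δ.opD_le_opN, δ.isClosedOperator_opD, fun ω => h ω.1 ω.2⟩⟩

/-- The domain clause of `∂∂_N = 0` is automatic because `ℓ² ⊆ D(∂)`. -/
theorem boundaryBoundaryNEqZero_iff : δ.BoundaryBoundaryNEqZero ↔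
    ∀ (b : K.Simplex → ℂ) (hb : b ∈ K.l2)
      (h : δ.boundary ⟨b, δ.l2_le_boundary_domain hb⟩ ∈ K.l2),
      δ.boundary ⟨_, δ.l2_le_boundary_domain h⟩ = 0 := by
  constructor
  · intro H b hb h
    exact (H ⟨b, ⟨hb, δ.l2_le_boundary_domain hb, h⟩, δ.l2_le_boundary_domain hb⟩).2
  · rintro H ⟨b, ⟨hb, hb1, h⟩, hb2⟩
    exact ⟨δ.l2_le_boundary_domain h, H b hb h⟩

theorem isIdealBoundaryCondition_opD_iff :
    δ.IsIdealBoundaryCondition δ.opD ↔ δ.BoundaryBoundaryNEqZero := by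
  rw [isIdealBoundaryCondition_opD_iff_range, boundaryBoundaryNEqZero_iff]
  have hN : ∀ ω ∈ δ.domainN, δ.op ω ∈ δ.domainN := fun ω hω =>
    ⟨hω.2, by
      rw [SetLike.mem_coe, Submodule.mem_comap, δ.op_op]
      exact K.l2.zero_mem⟩
  have hin : ∀ (ω : δ.domainN) (a b : K.l2), inner ℂ (δ.graphMap ⟨δ.op ω.1, hN _ ω.2⟩)
      (WithLp.toLp 2 (K.toHilbert a, K.toHilbert b)) =
      inner ℂ (K.toHilbert ⟨δ.op ω.1, ω.2.2⟩) (K.toHilbert a) := fun ω a b => by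
    have h0 : K.toHilbert ⟨δ.op (δ.op ω.1), (hN _ ω.2).2⟩ = 0 := by
      rw [← map_zero K.toHilbert]
      congr 1
      exact Subtype.ext (δ.op_op ω.1)
    rw [inner_graphMap, h0, inner_zero_left, add_zero]
  constructor
  · intro H b hb h
    funext ρ
    let s : δ.domainN := ⟨Pi.single ρ 1, δ.finSupp_le_domainN (single_mem_finSupp ρ)⟩
    have hs : s.1 ∈ δ.domainD := (δ.mem_domainD_iff s).2
      (Submodule.le_topologicalClosure _ ⟨s, single_mem_finSupp ρ, rfl⟩)
    have h1 := (δ.mem_domainD_iff_orthogonal ⟨_, hN _ s.2⟩).1 (H _ hs)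
    -- Pair `(δ 1_ρ, 0)` with `(-∂b, b)`.
    have h2 := (δ.mem_coreGraph_orthogonal_iff (-⟨_, h⟩) ⟨b, hb⟩).2 rfl
    have h3 := (Submodule.mem_orthogonal' _ _).1 h1 _ h2
    rw [hin, map_neg, inner_neg_right, neg_eq_zero, inner_op_single] at h3
    have : (K.m ρ.1 : ℂ) ≠ 0 := by exact_mod_cast (K.weight_pos ρ).ne'
    exact (mul_eq_zero.1 h3).resolve_left this
  · intro H ω hω
    let s : δ.domainN := ⟨ω, δ.domainD_le_domainN hω⟩
    refine (δ.mem_domainD_iff_orthogonal ⟨_, hN _ s.2⟩).2 ((Submodule.mem_orthogonal' _ _).2 ?_)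
    intro y hy
    obtain ⟨a, ha⟩ := K.toHilbert_surjective y.fst
    obtain ⟨b, hb⟩ := K.toHilbert_surjective y.snd
    obtain rfl : y = WithLp.toLp 2 (K.toHilbert a, K.toHilbert b) := by
      rw [ha, hb]
      rfl
    have h1 := (δ.mem_coreGraph_orthogonal_iff a b).1 hy
    have h2 : δ.boundary ⟨b.1, δ.l2_le_boundary_domain b.2⟩ = (-a).1 := by
      simp [h1]
    have h2' : δ.boundary ⟨b.1, δ.l2_le_boundary_domain b.2⟩ ∈ K.l2 := h2 ▸ (-a).2
    have h3 := H b.1 b.2 h2'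
    -- `∂∂b = 0` lets `∂b` serve as second component of an orthogonal pair whose first component is
    -- `0`.
    have h4 : WithLp.toLp 2 (K.toHilbert 0, K.toHilbert (⟨_, h2'⟩ : K.l2)) ∈ δ.coreGraphᗮ :=
      (δ.mem_coreGraph_orthogonal_iff 0 ⟨_, h2'⟩).2 (by simp [h3])
    have h5 := (Submodule.mem_orthogonal' _ _).1 ((δ.mem_domainD_iff_orthogonal s).1 hω) _ h4
    have h6 : (⟨_, h2'⟩ : K.l2) = -a := Subtype.ext h2
    rw [inner_graphMap, map_zero, inner_zero_right, zero_add, h6, map_neg, inner_neg_right,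
      neg_eq_zero] at h5
    rw [hin, h5]

end Coboundary

end WeightedSimplicialComplex


namespace WeightedGraph

variable {V : Type*} (G : WeightedGraph V)

/-! ### Recurrent graphs have null sequences -/

/-- Summability leaves each vertex only countably many neighbours, so the balls around `o` are
countable. Countability is needed for union bounds over the next position of the walk. -/
theorem countable_of_preconnected (hG : G.toSimpleGraph.Preconnected) : Countable V := by
  rcases isEmpty_or_nonempty V with hV | ⟨⟨o⟩⟩
  · infer_instance
  let S : ℕ → Set V := fun n => n.rec {o} fun _ s => ⋃ x ∈ s, Function.support (G.b x)
  have hS : ∀ n, (S n).Countable := fun n => by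
    induction n with
    | zero => exact Set.countable_singleton o
    | succ n ih => exact ih.biUnion fun x _ => (G.summable x).countable_support
  have hall : ∀ x, x ∈ ⋃ n, S n := fun x => by
    have h := (SimpleGraph.reachable_iff_reflTransGen _ _).1 (hG o x)
    induction h with
    | refl => exact Set.mem_iUnion.2 ⟨0, rfl⟩
    | tail _ hxy ih =>
      obtain ⟨n, hn⟩ := Set.mem_iUnion.1 ih
      exact Set.mem_iUnion.2 ⟨n + 1, Set.mem_biUnion hn (ne_of_gt hxy)⟩
  exact Set.countable_univ_iff.1 ((Set.countable_iUnion hS).mono fun x _ => hall x)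

/-- The edge weights as extended nonnegative numbers. -/
def weight (x y : V) : ℝ≥0∞ := ENNReal.ofReal (G.b x y)

/-- The total weight of the edges at a vertex. -/
def degree (x : V) : ℝ≥0∞ := ∑' y, G.weight x y

/-- The transition probabilities as extended nonnegative numbers. -/
def prob (x y : V) : ℝ≥0∞ := ENNReal.ofReal (G.transition x y)

theorem weight_symm (x y : V) : G.weight x y = G.weight y x := by
  rw [weight, weight, G.symm]

theorem degree_eq (x : V) : G.degree x = ENNReal.ofReal (∑' y, G.b x y) :=
  (ENNReal.ofReal_tsum_of_nonneg (G.nonneg x) (G.summable x)).symm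

theorem degree_ne_top (x : V) : G.degree x ≠ ∞ := by
  rw [degree_eq]
  exact ENNReal.ofReal_ne_top

theorem degree_mul_prob (x y : V) : G.degree x * G.prob x y = G.weight x y := by
  rw [degree_eq, prob, weight, ← ENNReal.ofReal_mul (tsum_nonneg (G.nonneg x))]
  congr 1
  by_cases h : ∑' z, G.b x z = 0
  · have h1 := (G.summable x).le_tsum y fun z _ => G.nonneg x z
    rw [h] at h1 ⊢
    rw [zero_mul, le_antisymm h1 (G.nonneg x y)]
  · rw [transition, if_neg h]
    field_simp

theorem tsum_prob (x : V) : ∑' y, G.prob x y = 1 := by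
  classical
  by_cases h : ∑' z, G.b x z = 0
  · rw [tsum_eq_single x]
    · simp [prob, transition, h]
    · intro y hy
      simp [prob, transition, h, hy.symm]
  · have h1 := G.degree_mul_prob x
    have h2 : G.degree x ≠ 0 := by
      rw [degree_eq]
      simpa using lt_of_le_of_ne (tsum_nonneg (G.nonneg x)) (Ne.symm h)
    have h3 : G.degree x * ∑' y, G.prob x y = G.degree x * 1 := by
      rw [← ENNReal.tsum_mul_left, mul_one, degree]
      exact tsum_congr h1
    exact (ENNReal.mul_right_inj h2 (G.degree_ne_top x)).1 h3

/-! ### Hitting probabilities in finite sets -/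

open Classical in
/-- The probability that the walk started at a vertex hits `o` within `n` steps and stays in the
finite set `F` until then. -/
def hit (o : V) (F : Finset V) : ℕ → V → ℝ≥0∞
  | 0, x => if x = o then 1 else 0
  | n + 1, x => if x = o then 1 else if x ∈ F then ∑ y ∈ F, G.prob x y * hit o F n y else 0

theorem hit_self (o : V) (F : Finset V) (n : ℕ) : G.hit o F n o = 1 := by
  cases n <;> simp [hit]

theorem hit_succ_of_mem {o x : V} {F : Finset V} (n : ℕ) (ho : x ≠ o) (hx : x ∈ F) :
    G.hit o F (n + 1) x = ∑ y ∈ F, G.prob x y * G.hit o F n y := by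
  simp [hit, ho, hx]

theorem hit_of_notMem {o x : V} {F : Finset V} (n : ℕ) (ho : x ≠ o) (hx : x ∉ F) :
    G.hit o F n x = 0 := by
  cases n <;> simp [hit, ho, hx]

theorem hit_le_one (o : V) (F : Finset V) (n : ℕ) (x : V) : G.hit o F n x ≤ 1 := by
  induction n generalizing x with
  | zero =>
    rw [hit]
    split_ifs <;> simp
  | succ n ih =>
    rw [hit]
    split_ifs
    · rfl
    · calc ∑ y ∈ F, G.prob x y * G.hit o F n y ≤ ∑ y ∈ F, G.prob x y :=
            Finset.sum_le_sum fun y _ => mul_le_of_le_one_right' (ih y)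
        _ ≤ 1 := (ENNReal.sum_le_tsum F).trans_eq (G.tsum_prob x)
    · simp

theorem hit_mono_set (o : V) {F F' : Finset V} (h : F ⊆ F') (n : ℕ) (x : V) :
    G.hit o F n x ≤ G.hit o F' n x := by
  induction n generalizing x with
  | zero => rfl
  | succ n ih =>
    by_cases ho : x = o
    · rw [ho, hit_self, hit_self]
    by_cases hx : x ∈ F
    · rw [hit_succ_of_mem G n ho hx, hit_succ_of_mem G n ho (h hx)]
      exact (Finset.sum_le_sum fun y _ => mul_le_mul_right (ih y) _).trans
        (Finset.sum_le_sum_of_subset h)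
    · rw [hit_of_notMem G _ ho hx]
      exact zero_le

theorem hit_monotone (o : V) (F : Finset V) (x : V) : Monotone fun n => G.hit o F n x := by
  refine monotone_nat_of_le_succ fun n => ?_
  induction n generalizing x with
  | zero =>
    by_cases ho : x = o
    · rw [ho, hit_self, hit_self]
    · simp [hit, ho]
  | succ n ih =>
    by_cases ho : x = o
    · rw [ho, hit_self, hit_self]
    by_cases hx : x ∈ F
    · rw [hit_succ_of_mem G n ho hx, hit_succ_of_mem G _ ho hx]
      exact Finset.sum_le_sum fun y _ => mul_le_mul_right (ih y) _
    · rw [hit_of_notMem G _ ho hx]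
      exact zero_le

/-- Hitting probabilities increase with `F`, so in a finite partial sum the suprema are approached
by a common `F`, which is then enlarged to contain the summation set. -/
theorem tsum_prob_mul_iSup_hit_le (o x : V) (n : ℕ) :
    ∑' y, G.prob x y * ⨆ F, G.hit o F n y ≤ ⨆ F, ∑ y ∈ F, G.prob x y * G.hit o F n y := by
  classical
  rw [ENNReal.tsum_eq_iSup_sum]
  refine iSup_le fun s => ?_
  simp only [ENNReal.mul_iSup]
  rw [ENNReal.finsetSum_iSup_of_monotone (f := fun y F => G.prob x y * G.hit o F n y)
    fun y F F' h => mul_le_mul_right (G.hit_mono_set o h n y) _]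
  refine iSup_le fun F => le_iSup_of_le (F ∪ s) ?_
  exact (Finset.sum_le_sum fun y _ =>
    mul_le_mul_right (G.hit_mono_set o Finset.subset_union_left n y) _).trans
    (Finset.sum_le_sum_of_subset Finset.subset_union_right)

theorem iSup_sum_le_iSup_hit {o x : V} (hx : x ≠ o) (n : ℕ) :
    ⨆ F, ∑ y ∈ F, G.prob x y * G.hit o F n y ≤ ⨆ F, G.hit o F (n + 1) x := by
  classical
  refine iSup_le fun F => le_iSup_of_le (insert x F) ?_
  rw [hit_succ_of_mem G n hx (Finset.mem_insert_self x F)]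
  exact (Finset.sum_le_sum fun y _ =>
    mul_le_mul_right (G.hit_mono_set o (Finset.subset_insert x F) n y) _).trans
    (Finset.sum_le_sum_of_subset (Finset.subset_insert x F))

/-! ### Comparison of the walk with hitting probabilities -/

variable {G}

theorem IsWalkLaw.measure_extend {x : V} {P : Measure (Trajectory V)} (hP : G.IsWalkLaw x P)
    (n : ℕ) (a : ℕ → V) (y : V) :
    P {Y : Trajectory V | ∀ i ≤ n + 1, Y i = Function.update a (n + 1) y i} =
      P {Y : Trajectory V | ∀ i ≤ n, Y i = a i} * G.prob (a n) y := by
  rw [hP.2, hP.2, Function.update_of_ne (Nat.succ_ne_zero n).symm]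
  split_ifs
  · rw [Finset.prod_range_succ, Function.update_self,
      Function.update_of_ne (Nat.succ_ne_self n).symm]
    congr 1
    refine Finset.prod_congr rfl fun i hi => ?_
    have hi := Finset.mem_range.1 hi
    rw [Function.update_of_ne (by omega), Function.update_of_ne (by omega)]
  · simp

/-- The Markov property as a one-step inequality: split by the value of `Y (n + 1)`. Only upper
bounds are needed, so countable subadditivity suffices and the events need not be shown measurable.
-/
theorem IsWalkLaw.measure_inter_hit_succ_le [Countable V] {x : V} {P : Measure (Trajectory V)}
    (hP : G.IsWalkLaw x P) (o : V) (n N : ℕ) (a : ℕ → V) (w : V → ℝ≥0∞)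
    (hw : ∀ a : ℕ → V, P {Y : Trajectory V | (∀ i ≤ n + 1, Y i = a i) ∧
      ∃ k, n + 1 ≤ k ∧ k ≤ n + 1 + N ∧ Y k = o} ≤
        P {Y : Trajectory V | ∀ i ≤ n + 1, Y i = a i} * w (a (n + 1))) :
    P {Y : Trajectory V | (∀ i ≤ n, Y i = a i) ∧ ∃ k, n + 1 ≤ k ∧ k ≤ n + 1 + N ∧ Y k = o} ≤
      P {Y : Trajectory V | ∀ i ≤ n, Y i = a i} * ∑' y, G.prob (a n) y * w y := by
  classical
  calc _ ≤ P (⋃ y, {Y : Trajectory V | (∀ i ≤ n + 1, Y i = Function.update a (n + 1) y i) ∧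
          ∃ k, n + 1 ≤ k ∧ k ≤ n + 1 + N ∧ Y k = o}) := by
        refine measure_mono fun Y hY => Set.mem_iUnion.2 ⟨Y (n + 1), fun i hi => ?_, hY.2⟩
        rcases Nat.le_succ_iff.1 hi with h | h
        · rw [Function.update_of_ne (by omega), hY.1 i h]
        · rw [h, Function.update_self]
    _ ≤ ∑' y, P {Y : Trajectory V | (∀ i ≤ n + 1, Y i = Function.update a (n + 1) y i) ∧
          ∃ k, n + 1 ≤ k ∧ k ≤ n + 1 + N ∧ Y k = o} := measure_iUnion_le _
    _ ≤ ∑' y, P {Y : Trajectory V | ∀ i ≤ n, Y i = a i} * (G.prob (a n) y * w y) := by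
        refine ENNReal.tsum_le_tsum fun y => (hw _).trans_eq ?_
        rw [hP.measure_extend, Function.update_self, mul_assoc]
    _ = _ := ENNReal.tsum_mul_left

/-- Induction on the remaining time `N`; the history up to time `n` matters only through its last
position. -/
theorem IsWalkLaw.measure_inter_hit_le [Countable V] {x : V} {P : Measure (Trajectory V)}
    (hP : G.IsWalkLaw x P) (o : V) (N n : ℕ) (a : ℕ → V) :
    P {Y : Trajectory V | (∀ i ≤ n, Y i = a i) ∧ ∃ k, n ≤ k ∧ k ≤ n + N ∧ Y k = o} ≤
      P {Y : Trajectory V | ∀ i ≤ n, Y i = a i} * ⨆ F, G.hit o F N (a n) := by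
  by_cases ho : a n = o
  · simp only [ho, hit_self, ciSup_const, mul_one]
    exact measure_mono fun Y hY => hY.1
  induction N generalizing n a with
  | zero =>
    refine le_of_eq_of_le ?_ zero_le
    convert measure_empty (μ := P)
    refine Set.eq_empty_of_forall_notMem ?_
    rintro Y ⟨h1, k, h2, h3, h4⟩
    obtain rfl : n = k := by omega
    exact ho (h1 n le_rfl ▸ h4)
  | succ N ih =>
    have h1 := hP.measure_inter_hit_succ_le o n N a (fun y => ⨆ F, G.hit o F N y) fun a => by
      by_cases ho : a (n + 1) = o
      · simp only [ho, hit_self, ciSup_const, mul_one]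
        exact measure_mono fun Y hY => hY.1
      · exact ih (n + 1) a ho
    refine le_trans (measure_mono ?_) (h1.trans (mul_le_mul_right
      ((G.tsum_prob_mul_iSup_hit_le o _ N).trans (G.iSup_sum_le_iSup_hit ho N)) _))
    rintro Y ⟨h2, k, h3, h4, h5⟩
    refine ⟨h2, k, ?_, by omega, h5⟩
    refine lt_of_le_of_ne h3 ?_
    rintro rfl
    exact ho (h2 n le_rfl ▸ h5)

theorem IsWalkLaw.measure_return_le [Countable V] {o : V} {P : Measure (Trajectory V)}
    (hP : G.IsWalkLaw o P) :
    P {Y : Trajectory V | ∃ k > 0, Y k = o} ≤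
      ⨆ N, ⨆ F, ∑ y ∈ F, G.prob o y * G.hit o F N y := by
  have := hP.1
  have h1 : {Y : Trajectory V | ∃ k > 0, Y k = o} =
      ⋃ N, {Y : Trajectory V | ∃ k, 0 + 1 ≤ k ∧ k ≤ 0 + 1 + N ∧ Y k = o} := by
    ext Y
    simp only [Set.mem_iUnion]
    exact ⟨fun ⟨k, h, h'⟩ => ⟨k, k, by omega, by omega, h'⟩,
      fun ⟨_, k, h, _, h'⟩ => ⟨k, by omega, h'⟩⟩
  have h2 : Monotone fun N => {Y : Trajectory V | ∃ k, 0 + 1 ≤ k ∧ k ≤ 0 + 1 + N ∧ Y k = o} :=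
    fun N N' h Y ⟨k, h3, h4, h5⟩ => ⟨k, h3, by omega, h5⟩
  have h3 : P {Y : Trajectory V | ∀ i ≤ 0, Y i = o} = 1 := by
    simpa using hP.2 0 fun _ => o
  have h4 : MeasurableSet {Y : Trajectory V | ∀ i ≤ 0, Y i = o} := by
    have e : {Y : Trajectory V | ∀ i ≤ 0, Y i = o} = (fun Y : ℕ → V => Y 0) ⁻¹' {o} := by
      ext Y
      exact ⟨fun h => h 0 le_rfl, fun h i hi => by rw [Nat.le_zero.1 hi]; exact h⟩
    rw [e]
    let _ : MeasurableSpace V := ⊤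
    exact (measurable_pi_apply (X := fun _ : ℕ => V) 0) MeasurableSpace.measurableSet_top
  have h5 := (prob_compl_eq_zero_iff h4).2 h3
  rw [h1, h2.measure_iUnion]
  refine iSup_mono fun N => ?_
  refine le_trans ?_ (G.tsum_prob_mul_iSup_hit_le o o N)
  have h6 := hP.measure_inter_hit_succ_le o 0 N (fun _ => o) (fun y => ⨆ F, G.hit o F N y)
    fun a => hP.measure_inter_hit_le o N (0 + 1) a
  rw [h3, one_mul] at h6
  refine le_trans ?_ h6
  -- Paths that do not start at `o` form a null set.
  refine (measure_mono (t := {Y : Trajectory V | (∀ i ≤ 0, Y i = o) ∧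
    ∃ k, 0 + 1 ≤ k ∧ k ≤ 0 + 1 + N ∧ Y k = o} ∪ {Y : Trajectory V | ∀ i ≤ 0, Y i = o}ᶜ)
    fun Y hY => ?_).trans ((measure_union_le _ _).trans_eq (by rw [h5, add_zero]))
  by_cases h : Y ∈ {Y : Trajectory V | ∀ i ≤ 0, Y i = o}
  · exact Or.inl ⟨h, hY⟩
  · exact Or.inr h

/-! ### Energy and null sequences -/

variable (G)

/-- The energy of a function, with every edge counted twice. -/
def energy (f : V → ℝ) : ℝ≥0∞ := ∑' x, ∑' y, ENNReal.ofReal (G.b x y * (f x - f y) ^ 2)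

/-- Green's formula, arranged without subtraction. With `S = ∑ b h(x) h(y)` and `T = ∑ deg h²`,
expanding squares gives `energy + 2S = 2T`; harmonicity off `o` gives `T + R = S + deg(o)`. Finite
support makes `S` finite, so it cancels. -/
theorem energy_add (o : V) (h : V → ℝ≥0∞) (ho : h o = 1) (h1 : ∀ x, h x ≤ 1)
    (hfin : h.support.Finite)
    (hharm : ∀ x, x ≠ o → h x ≠ 0 → G.degree x * h x = ∑' y, G.weight x y * h y) :
    G.energy (fun x => (h x).toReal) + 2 * ∑' y, G.weight o y * h y = 2 * G.degree o := by
  classical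
  have htop : ∀ x, h x ≠ ∞ := fun x => ((h1 x).trans_lt ENNReal.one_lt_top).ne
  set S := ∑' x, ∑' y, G.weight x y * (h x * h y) with hS
  set T := ∑' x, G.degree x * (h x * h x) with hT
  set R := ∑' y, G.weight o y * h y with hR
  have e1 : G.energy (fun x => (h x).toReal) + 2 * S = 2 * T := by
    have hp : ∀ x y, ENNReal.ofReal (G.b x y * ((h x).toReal - (h y).toReal) ^ 2) +
        2 * (G.weight x y * (h x * h y)) =
        G.weight x y * (h x * h x) + G.weight x y * (h y * h y) := fun x y => by
      have hb := G.nonneg x y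
      have h2 : (2 : ℝ≥0∞) = ENNReal.ofReal 2 := by simp
      have hxn := (h x).toReal_nonneg
      have hyn := (h y).toReal_nonneg
      rw [weight, ← ENNReal.ofReal_toReal (htop x), ← ENNReal.ofReal_toReal (htop y), h2]
      rw [ENNReal.toReal_ofReal hxn, ENNReal.toReal_ofReal hyn]
      simp only [← ENNReal.ofReal_mul hxn, ← ENNReal.ofReal_mul hyn, ← ENNReal.ofReal_mul hb,
        ← ENNReal.ofReal_mul zero_le_two]
      rw [← ENNReal.ofReal_add (by positivity) (by positivity),
        ← ENNReal.ofReal_add (by positivity) (by positivity)]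
      congr 1
      ring
    have hT1 : ∑' x, ∑' y, G.weight x y * (h x * h x) = T := by
      simp only [ENNReal.tsum_mul_right]
      rfl
    have hT2 : ∑' x, ∑' y, G.weight x y * (h y * h y) = T := by
      rw [ENNReal.tsum_comm, ← hT1]
      exact tsum_congr fun x => tsum_congr fun y => by rw [G.weight_symm]
    rw [energy, hS, ← ENNReal.tsum_mul_left, ← ENNReal.tsum_add, two_mul T]
    nth_rw 1 [← hT1]
    rw [← hT2, ← ENNReal.tsum_add]
    refine tsum_congr fun x => ?_
    rw [← ENNReal.tsum_mul_left, ← ENNReal.tsum_add, ← ENNReal.tsum_add]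
    exact tsum_congr (hp x)
  have e2 : T + R = S + G.degree o := by
    -- Writing both constants as sums concentrated at `o` allows a vertexwise comparison.
    rw [← tsum_ite_eq o fun _ => R, ← tsum_ite_eq o fun _ => G.degree o, hT, hS,
      ← ENNReal.tsum_add, ← ENNReal.tsum_add]
    refine tsum_congr fun x => ?_
    have e : ∑' y, G.weight x y * (h x * h y) = h x * ∑' y, G.weight x y * h y := by
      rw [← ENNReal.tsum_mul_left]
      exact tsum_congr fun y => by ring
    rw [e]
    by_cases hx : x = o
    · subst hx
      simp only [ho, if_true, one_mul, mul_one]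
      rw [add_comm]
    · simp only [hx, if_false, add_zero]
      by_cases h0 : h x = 0
      · simp [h0]
      · rw [← hharm x hx h0]
        ring
  have hTtop : T ≠ ∞ := by
    rw [hT, tsum_eq_sum (s := hfin.toFinset) fun x hx => by
      have : h x = 0 := by simpa using hx
      simp [this]]
    exact (ENNReal.sum_lt_top.2 fun x _ => ENNReal.mul_lt_top (G.degree_ne_top x).lt_top
      (ENNReal.mul_lt_top (htop x).lt_top (htop x).lt_top)).ne
  have hStop : 2 * S ≠ ∞ := by
    refine ne_top_of_le_ne_top (ENNReal.mul_ne_top (by simp) hTtop) (b := 2 * T) ?_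
    rw [← e1]
    exact le_add_self
  have e3 : 2 * S + (G.energy (fun x => (h x).toReal) + 2 * R) = 2 * S + 2 * G.degree o := by
    rw [← mul_add, ← e2, mul_add, ← e1]
    ring
  exact (ENNReal.add_right_inj hStop).1 e3

theorem exists_energy_le [Countable V] {o : V} {P : Measure (Trajectory V)}
    (hP : G.IsWalkLaw o P) (hrec : P {Y : Trajectory V | ∃ k > 0, Y k = o} = 1)
    {ε : ℝ≥0∞} (hε : ε ≠ 0) :
    ∃ f : V → ℝ, f.support.Finite ∧ (∀ x, 0 ≤ f x) ∧ (∀ x, f x ≤ 1) ∧ f o = 1 ∧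
      G.energy f ≤ ε := by
  classical
  -- A return probability of at least `c` leaves energy at most `2 deg(o) (1 - c) ≤ ε`. If `deg(o) =
  -- 0`, the quotient is `∞` and `c = 0`, which is harmless.
  set c : ℝ≥0∞ := 1 - ε / (2 * G.degree o) with hc
  have hc1 : c < 1 := by
    refine ENNReal.sub_lt_self (by simp) (by simp) ?_
    exact (ENNReal.div_pos hε (ENNReal.mul_ne_top (by simp) (G.degree_ne_top o))).ne'
  have h1 := hP.measure_return_le
  rw [hrec] at h1
  obtain ⟨N, hN⟩ := lt_iSup_iff.1 (hc1.trans_le h1)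
  obtain ⟨F₀, hF₀⟩ := lt_iSup_iff.1 hN
  set F := insert o F₀ with hF
  -- Letting time tend to infinity with `F` fixed makes `h` harmonic on `F \ {o}`.
  set h : V → ℝ≥0∞ := fun x => ⨆ n, G.hit o F n x with hh
  have ho : h o = 1 := by simp [hh, hit_self]
  have hle : ∀ x, h x ≤ 1 := fun x => iSup_le fun n => G.hit_le_one o F n x
  have h0 : ∀ x, x ∉ F → h x = 0 := fun x hx => by
    have hxo : x ≠ o := fun e => hx (e ▸ Finset.mem_insert_self o F₀)
    simp [hh, G.hit_of_notMem _ hxo hx]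
  have htsum : ∀ x, ∑' y, G.weight x y * h y = G.degree x * ∑ y ∈ F, G.prob x y * h y :=
    fun x => by
    rw [tsum_eq_sum (s := F) fun y hy => by rw [h0 y hy, mul_zero], Finset.mul_sum]
    exact Finset.sum_congr rfl fun y _ => by rw [← mul_assoc, degree_mul_prob]
  have hharm : ∀ x, x ≠ o → h x ≠ 0 → G.degree x * h x = ∑' y, G.weight x y * h y := by
    intro x hx hx0
    have hxF : x ∈ F := by
      by_contra hxF
      exact hx0 (h0 x hxF)
    rw [htsum]
    congr 1
    simp only [hh, ENNReal.mul_iSup]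
    rw [ENNReal.finsetSum_iSup_of_monotone (f := fun y n => G.prob x y * G.hit o F n y)
      fun y n n' hn => mul_le_mul_right (G.hit_monotone o F y hn) _]
    rw [← (G.hit_monotone o F x).iSup_nat_add 1]
    exact iSup_congr fun n => G.hit_succ_of_mem n hx hxF
  have hfin : h.support.Finite := F.finite_toSet.subset fun x hx => by
    by_contra hxF
    exact hx (h0 x hxF)
  refine ⟨fun x => (h x).toReal, hfin.subset fun x hx => ?_, fun x => ENNReal.toReal_nonneg,
    fun x => ENNReal.toReal_le_of_le_ofReal zero_le_one (by simpa using hle x), by simp [ho], ?_⟩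
  · contrapose! hx
    simp only [Function.mem_support, not_not] at hx ⊢
    simp [hx]
  have hR : c ≤ ∑ y ∈ F, G.prob o y * h y := by
    refine hF₀.le.trans ((Finset.sum_le_sum fun y _ => mul_le_mul_right ?_ _).trans
      (Finset.sum_le_sum_of_subset (Finset.subset_insert o F₀)))
    exact (G.hit_mono_set o (Finset.subset_insert o F₀) N y).trans
      (le_iSup (fun n => G.hit o F n y) N)
  have hE := G.energy_add o h ho hle hfin hharm
  rw [htsum, ← mul_assoc] at hE
  set M := 2 * G.degree o
  have hM : M ≠ ∞ := ENNReal.mul_ne_top (by simp) (G.degree_ne_top o)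
  have hle2 : G.energy (fun x => (h x).toReal) + M * c ≤ M * c + ε := by
    calc _ ≤ _ := add_le_add_right (mul_le_mul_right hR M) _
      _ = M := hE
      _ = M * 1 := (mul_one M).symm
      _ ≤ M * (c + ε / M) := mul_le_mul_right (by rw [hc]; exact le_tsub_add) _
      _ ≤ M * c + ε := by
          rw [mul_add]
          exact add_le_add_right ENNReal.mul_div_le _
  rw [add_comm] at hle2
  exact (ENNReal.add_le_add_iff_left (ENNReal.mul_ne_top hM (hc1.trans ENNReal.one_lt_top).ne)).1
    hle2

/-- A recurrent connected graph has a null sequence. -/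
theorem exists_null_sequence (hG : G.toSimpleGraph.Preconnected) (hrec : G.IsRecurrent) :
    ∃ f : ℕ → V → ℝ, (∀ n, (f n).support.Finite) ∧ (∀ n x, 0 ≤ f n x) ∧ (∀ n x, f n x ≤ 1) ∧
      (∀ x, Tendsto (fun n => f n x) atTop (𝓝 1)) ∧
      Tendsto (fun n => G.energy (f n)) atTop (𝓝 0) := by
  have := G.countable_of_preconnected hG
  rcases isEmpty_or_nonempty V with hV | ⟨⟨o⟩⟩
  · exact ⟨0, by simp, by simp, by simp, fun x => hV.elim x, by simp [energy]⟩
  obtain ⟨P, hP, hP'⟩ := hrec o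
  choose f hf h0 h1 ho hE using fun n : ℕ =>
    G.exists_energy_le hP (hP' o) (ε := (n : ℝ≥0∞)⁻¹) (by simp)
  have hE' : Tendsto (fun n => G.energy (f n)) atTop (𝓝 0) :=
    tendsto_of_tendsto_of_tendsto_of_le_of_le tendsto_const_nhds
      ENNReal.tendsto_inv_nat_nhds_zero (fun _ => zero_le) hE
  refine ⟨f, hf, h0, h1, fun x => ?_, hE'⟩
  have h := (SimpleGraph.reachable_iff_reflTransGen _ _).1 (hG o x)
  induction h with
  | refl => simp [ho]
  -- One edge of positive weight bounds `(f_n x - f_n y)²` by a multiple of the energy, so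
  -- convergence to `1` spreads along paths from `o`.
  | @tail x y _ hxy ih =>
    have hxy : 0 < G.b x y := hxy
    have h2 : Tendsto (fun n => ENNReal.ofReal (G.b x y * (f n x - f n y) ^ 2)) atTop (𝓝 0) :=
      tendsto_of_tendsto_of_tendsto_of_le_of_le tendsto_const_nhds hE' (fun _ => zero_le)
        fun n => (ENNReal.le_tsum (f := fun y =>
          ENNReal.ofReal (G.b x y * (f n x - f n y) ^ 2)) y).trans (ENNReal.le_tsum (f := fun x =>
          ∑' y, ENNReal.ofReal (G.b x y * (f n x - f n y) ^ 2)) x)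
    have h3 := (((ENNReal.tendsto_toReal (by simp)).comp h2).div_const (G.b x y)).sqrt
    have h4 : Tendsto (fun n => |f n x - f n y|) atTop (𝓝 0) := by
      refine (h3.congr fun n => ?_).trans (by simp)
      simp only [Function.comp]
      rw [ENNReal.toReal_ofReal (by positivity), mul_div_cancel_left₀ _ hxy.ne',
        Real.sqrt_sq_eq_abs]
    have h5 := ih.sub ((tendsto_zero_iff_abs_tendsto_zero _).2 h4)
    simpa using h5

end WeightedGraph


theorem IsFace.exists_eq_insert {X : Type*} [DecidableEq X] {τ σ : Finset X} (h : IsFace τ σ) :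
    ∃ v ∉ τ, σ = insert v τ := by
  obtain ⟨v, hv, e⟩ := Finset.exists_eq_insert_iff.2 ⟨h.1, h.2.symm⟩
  exact ⟨v, hv, e.symm⟩

theorem isFace_insert {X : Type*} [DecidableEq X] {τ : Finset X} {v : X} (h : v ∉ τ) :
    IsFace τ (insert v τ) :=
  ⟨Finset.subset_insert v τ, Finset.card_insert_of_notMem h⟩

namespace WeightedSimplicialComplex

theorem mem_simplices_of_subset {X : Type*} {K : WeightedSimplicialComplex X}
    {σ τ : Finset X} (hσ : σ ∈ K.simplices) (h : τ ⊆ σ)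
    (hτ : τ.Nonempty) : τ ∈ K.simplices :=
  ⟨K.down_closed σ hσ.1 τ h, fun e => absurd e hτ.ne_empty⟩

variable {X : Type*} [DecidableEq X] {K : WeightedSimplicialComplex X}

/-! ### Functions on links -/

/-- The coface `{v} ∪ ρ` of `ρ` given by an element `v` of the link. -/
def linkCoface (ρ : K.Simplex) (v : K.Link ρ) : K.Simplex := ⟨insert v.1 ρ.1, v.2.2⟩

theorem isFace_linkCoface (ρ : K.Simplex) (v : K.Link ρ) : IsFace ρ.1 (linkCoface ρ v).1 :=
  isFace_insert v.2.1

theorem linkCoface_injective (ρ : K.Simplex) : Function.Injective (linkCoface ρ) := by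
  intro v w h
  have h0 : insert v.1 ρ.1 = insert w.1 ρ.1 := congrArg Subtype.val h
  have h1 : v.1 ∈ insert w.1 ρ.1 := h0 ▸ Finset.mem_insert_self _ _
  exact Subtype.ext ((Finset.mem_insert.1 h1).resolve_right v.2.1)

theorem exists_linkCoface {ρ τ : K.Simplex} (h : IsFace ρ.1 τ.1) : ∃ v, linkCoface ρ v = τ := by
  obtain ⟨v, hv, e⟩ := h.exists_eq_insert
  exact ⟨⟨v, hv, e ▸ τ.2⟩, Subtype.ext e.symm⟩

namespace Coboundary

variable (δ : K.Coboundary)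

/-- The only faces of `ρ ∪ {v, w}` containing `ρ` are `ρ ∪ {v}` and `ρ ∪ {w}`. -/
theorem op_apply_of_pair {ρ : K.Simplex} {g : K.Simplex → ℂ}
    (hg : ∀ τ, ¬ IsFace ρ.1 τ.1 → g τ = 0) {v w : K.Link ρ} (hvw : v ≠ w) {σ : K.Simplex}
    (hσ : σ.1 = insert v.1 (insert w.1 ρ.1)) :
    δ.op g σ = δ.θ (linkCoface ρ v) σ * g (linkCoface ρ v) +
      δ.θ (linkCoface ρ w) σ * g (linkCoface ρ w) := by
  classical
  have hvw' : v.1 ≠ w.1 := fun h => hvw (Subtype.ext h)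
  have hw : IsFace (linkCoface ρ w).1 σ.1 := by
    rw [hσ]
    exact isFace_insert (by simp [linkCoface, hvw', v.2.1])
  have hv : IsFace (linkCoface ρ v).1 σ.1 := by
    rw [hσ, Finset.insert_comm]
    exact isFace_insert (by simp [linkCoface, hvw'.symm, w.2.1])
  have hne : (⟨_, hv⟩ : {τ : K.Simplex // IsFace τ.1 σ.1}) ≠ ⟨_, hw⟩ := fun h =>
    hvw (linkCoface_injective ρ (congrArg Subtype.val h))
  rw [δ.op_apply, finsum_eq_sum_of_support_subset (s := {⟨_, hv⟩, ⟨_, hw⟩}),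
    Finset.sum_pair hne]
  · rfl
  · rintro ⟨τ, hτ⟩ h
    have h1 : IsFace ρ.1 τ.1 := by
      by_contra h2
      exact h (by simp [hg τ h2])
    obtain ⟨u, rfl⟩ := exists_linkCoface h1
    have h3 : u.1 ∈ insert v.1 (insert w.1 ρ.1) := hσ ▸ hτ.1 (Finset.mem_insert_self _ _)
    simp only [Finset.mem_insert, u.2.1, or_false] at h3
    rcases h3 with h3 | h3
    · obtain rfl : u = v := Subtype.ext h3
      simp
    · obtain rfl : u = w := Subtype.ext h3
      simp

/-- This is `δδ 1_ρ = 0` evaluated at `σ`. -/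
theorem θ_mul_θ_add {ρ : K.Simplex} {v w : K.Link ρ} (hvw : v ≠ w) {σ : K.Simplex}
    (hσ : σ.1 = insert v.1 (insert w.1 ρ.1)) :
    δ.θ (linkCoface ρ v) σ * δ.θ ρ (linkCoface ρ v) +
      δ.θ (linkCoface ρ w) σ * δ.θ ρ (linkCoface ρ w) = 0 := by
  have h := δ.op_apply_of_pair (g := δ.op (Pi.single ρ 1)) (fun τ hτ => δ.θ_eq_zero hτ) hvw hσ
  rw [δ.op_op] at h
  exact h.symm

/-- The function `ρ ∪ {v} ↦ θ(ρ, ρ ∪ {v}) f(v)` given by a function `f` on the link of `ρ`. -/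
def linkFun (ρ : K.Simplex) (f : K.Link ρ → ℝ) (τ : K.Simplex) : ℂ :=
  δ.θ ρ τ * (Function.extend (linkCoface ρ) f 0 τ : ℝ)

theorem linkFun_linkCoface (ρ : K.Simplex) (f : K.Link ρ → ℝ) (v : K.Link ρ) :
    δ.linkFun ρ f (linkCoface ρ v) = δ.θ ρ (linkCoface ρ v) * f v := by
  rw [linkFun, (linkCoface_injective ρ).extend_apply]

theorem linkFun_eq_zero {ρ : K.Simplex} (f : K.Link ρ → ℝ) {τ : K.Simplex}
    (h : ¬ IsFace ρ.1 τ.1) : δ.linkFun ρ f τ = 0 := by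
  rw [linkFun, δ.θ_eq_zero h, zero_mul]

theorem linkFun_mem_finSupp {ρ : K.Simplex} {f : K.Link ρ → ℝ} (hf : f.support.Finite) :
    δ.linkFun ρ f ∈ K.finSupp := by
  refine (hf.image (linkCoface ρ)).subset fun τ hτ => ?_
  have h1 : IsFace ρ.1 τ.1 := by
    by_contra h
    exact hτ (δ.linkFun_eq_zero f h)
  obtain ⟨v, rfl⟩ := exists_linkCoface h1
  refine ⟨v, fun h => hτ ?_, rfl⟩
  rw [linkFun_linkCoface, h, Complex.ofReal_zero, mul_zero]

/-- By `θ_mul_θ_add` the values `f v` and `f w` enter with opposite signs. -/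
theorem norm_op_linkFun {ρ : K.Simplex} (f : K.Link ρ → ℝ) {v w : K.Link ρ} (hvw : v ≠ w)
    {σ : K.Simplex} (hσ : σ.1 = insert v.1 (insert w.1 ρ.1)) :
    ‖δ.op (δ.linkFun ρ f) σ‖ ^ 2 = (f v - f w) ^ 2 := by
  have h1 := δ.θ_mul_θ_add hvw hσ
  have hv : IsFace (linkCoface ρ v).1 σ.1 := by
    rw [hσ, Finset.insert_comm]
    have hwv : w.1 ≠ v.1 := fun h => hvw (Subtype.ext h.symm)
    exact isFace_insert (by simp [linkCoface, hwv, w.2.1])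
  have h2 := δ.θ_mul_self hv
  have h3 := δ.θ_mul_self (isFace_linkCoface ρ v)
  have h4 : ‖δ.θ (linkCoface ρ v) σ * δ.θ ρ (linkCoface ρ v)‖ ^ 2 = 1 := by
    rw [← norm_pow, mul_pow, sq, sq, h2, h3]
    simp
  rw [δ.op_apply_of_pair (fun τ => δ.linkFun_eq_zero f) hvw hσ, linkFun_linkCoface,
    linkFun_linkCoface]
  have h5 : δ.θ (linkCoface ρ v) σ * (δ.θ ρ (linkCoface ρ v) * f v) +
      δ.θ (linkCoface ρ w) σ * (δ.θ ρ (linkCoface ρ w) * f w) =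
      δ.θ (linkCoface ρ v) σ * δ.θ ρ (linkCoface ρ v) * ((f v - f w : ℝ) : ℂ) := by
    push_cast
    linear_combination (f w : ℂ) * h1
  rw [h5, norm_mul, mul_pow, h4, one_mul, Complex.norm_real, Real.norm_eq_abs, sq_abs]

theorem exists_of_op_linkFun_ne_zero {ρ : K.Simplex} {f : K.Link ρ → ℝ} {σ : K.Simplex}
    (h : δ.op (δ.linkFun ρ f) σ ≠ 0) :
    ∃ v w : K.Link ρ, v ≠ w ∧ σ.1 = insert v.1 (insert w.1 ρ.1) ∧ f v ≠ 0 := by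
  rw [δ.op_apply] at h
  obtain ⟨⟨τ, hτ⟩, h1⟩ : ∃ τ : {τ : K.Simplex // IsFace τ.1 σ.1},
      δ.op (Pi.single τ.1 1) σ * δ.linkFun ρ f τ.1 ≠ 0 := by
    by_contra! h0
    exact h (finsum_eq_zero_of_forall_eq_zero h0)
  have h2 := right_ne_zero_of_mul h1
  have h3 : IsFace ρ.1 τ.1 := by
    by_contra h
    exact h2 (δ.linkFun_eq_zero f h)
  obtain ⟨v, rfl⟩ := exists_linkCoface h3
  rw [linkFun_linkCoface] at h2
  obtain ⟨w, hw, e⟩ := hτ.exists_eq_insert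
  have hw' : w ≠ v.1 ∧ w ∉ ρ.1 := by simpa [linkCoface] using hw
  have e' : σ.1 = insert v.1 (insert w ρ.1) := by
    rw [e, Finset.insert_comm]
    rfl
  refine ⟨v, ⟨w, hw'.2, mem_simplices_of_subset σ.2 (e' ▸ Finset.subset_insert _ _)
    (Finset.insert_nonempty _ _)⟩, fun h => hw'.1 (congrArg Subtype.val h).symm, e', fun h => ?_⟩
  exact h2 (by simp [h])

/-- Simplices in the support are edges of `C`. Choosing one orientation for each injects them into
ordered pairs; only an inequality results, as the energy counts both orientations. -/
theorem normSq_op_linkFun_le {ρ : K.Simplex} (C : (K.linkGraph ρ).toSimpleGraph.ConnectedComponent)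
    {f : K.Link ρ → ℝ} (hf : ∀ v ∉ C.supp, f v = 0) :
    K.normSq (δ.op (δ.linkFun ρ f)) ≤ ((K.linkGraph ρ).restrict C.supp).energy fun v => f v := by
  have hpick : ∀ σ : Function.support (δ.op (δ.linkFun ρ f)), ∃ p : C.supp × C.supp,
      p.1.1 ≠ p.2.1 ∧ σ.1.1 = insert p.1.1.1 (insert p.2.1.1 ρ.1) := by
    rintro ⟨σ, hσ⟩
    obtain ⟨v, w, hvw, e, hv⟩ := δ.exists_of_op_linkFun_ne_zero hσ
    have hvC : v ∈ C.supp := by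
      by_contra h
      exact hv (hf v h)
    have hadj : (K.linkGraph ρ).toSimpleGraph.Adj v w := by
      change 0 < (K.linkGraph ρ).b v w
      have hmem : insert v.1 (insert w.1 ρ.1) ∈ K.simplices := e ▸ σ.2
      rw [linkGraph]
      simp only [hvw, hmem, ne_eq, not_false_eq_true, and_self, if_true]
      exact K.m_pos _ hmem.1
    exact ⟨(⟨v, hvC⟩, ⟨w, C.mem_supp_of_adj_mem_supp hvC hadj⟩), hvw, e⟩
  choose pick hne he using hpick
  have hinj : Function.Injective pick := fun σ σ' h => by
    refine Subtype.ext (Subtype.ext ?_)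
    rw [he σ, he σ', h]
  rw [normSq, ← tsum_subtype_eq_of_support_subset (s := Function.support (δ.op (δ.linkFun ρ f))),
    WeightedGraph.energy, ← ENNReal.tsum_prod]
  · refine le_trans (le_of_eq (tsum_congr fun σ => ?_)) (ENNReal.tsum_comp_le_tsum_of_injective hinj
      fun p => ENNReal.ofReal (((K.linkGraph ρ).restrict C.supp).b p.1 p.2 *
        (f p.1 - f p.2) ^ 2))
    rw [δ.norm_op_linkFun f (hne σ) (he σ)]
    have hmem : insert (pick σ).1.1.1 (insert (pick σ).2.1.1 ρ.1) ∈ K.simplices := he σ ▸ σ.1.2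
    simp only [WeightedGraph.restrict, linkGraph, hne σ, hmem, ne_eq, not_false_eq_true, and_self,
      if_true]
    rw [← he σ]
  · intro σ hσ h
    exact hσ (by simp [h])

/-! ### Vanishing of `∂∂b` at recurrent links -/

theorem hasSum_inner_linkFun {ρ : K.Simplex} {f : K.Link ρ → ℝ} (hf : δ.linkFun ρ f ∈ K.l2)
    (η : K.l2) :
    HasSum (fun v => (f v : ℂ) * (K.m (linkCoface ρ v).1 * (δ.θ ρ (linkCoface ρ v) *
      η.1 (linkCoface ρ v)))) (inner ℂ (K.toHilbert ⟨_, hf⟩) (K.toHilbert η)) := by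
  have h := K.hasSum_inner_toHilbert ⟨_, hf⟩ η
  rw [← (linkCoface_injective ρ).hasSum_iff] at h
  · refine h.congr_fun fun v => ?_
    simp only [Function.comp, linkFun_linkCoface, star_mul', star_θ]
    rw [show star (f v : ℂ) = f v from Complex.conj_ofReal _]
    ring
  · intro σ hσ
    simp [δ.linkFun_eq_zero f fun h => hσ (exists_linkCoface h)]

theorem inner_boundary {φ : K.Simplex → ℂ} (hφ : φ ∈ K.finSupp) (b : K.l2)
    (hb : δ.boundary ⟨b.1, δ.l2_le_boundary_domain b.2⟩ ∈ K.l2) :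
    inner ℂ (K.toHilbert ⟨φ, K.finSupp_le_l2 hφ⟩) (K.toHilbert ⟨_, hb⟩) =
      inner ℂ (K.toHilbert ⟨δ.op φ, (δ.finSupp_le_domainN hφ).2⟩) (K.toHilbert b) := by
  have h1 := (δ.mem_coreGraph_orthogonal_iff (-⟨_, hb⟩) b).2 rfl
  have h2 := (Submodule.mem_orthogonal _ _).1 h1 _ ⟨⟨φ, δ.finSupp_le_domainN hφ⟩, hφ, rfl⟩
  rw [inner_graphMap, map_neg, inner_neg_right] at h2
  exact neg_add_eq_zero.1 h2

/-- Test `∂b` against the lifted null sequence: dominated convergence gives the component sum as the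
limit, while moving `∂` across and Cauchy–Schwarz give the limit `0`. -/
theorem tsum_component_eq_zero {ρ : K.Simplex}
    (C : (K.linkGraph ρ).toSimpleGraph.ConnectedComponent)
    (hC : ((K.linkGraph ρ).restrict C.supp).IsRecurrent) (b : K.l2)
    (hb : δ.boundary ⟨b.1, δ.l2_le_boundary_domain b.2⟩ ∈ K.l2)
    {g : K.Link ρ → ℂ} (hg : Summable g)
    (hgb : ∀ v, g v = K.m (linkCoface ρ v).1 * (δ.θ ρ (linkCoface ρ v) *
      δ.boundary ⟨b.1, δ.l2_le_boundary_domain b.2⟩ (linkCoface ρ v))) :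
    ∑' v : C.supp, g v = 0 := by
  obtain ⟨f, hfin, h0, h1, hlim, hE⟩ := WeightedGraph.exists_null_sequence
    ((K.linkGraph ρ).restrict C.supp)
    (C.connected_toSimpleGraph.preconnected) hC
  let F : ℕ → K.Link ρ → ℝ := fun n => Function.extend Subtype.val (f n) 0
  have hF : ∀ n (v : C.supp), F n v = f n v := fun n v => Subtype.val_injective.extend_apply _ _ _
  have hF0 : ∀ n, ∀ v ∉ C.supp, F n v = 0 := fun n v hv =>
    Function.extend_apply' _ _ _ fun ⟨w, hw⟩ => hv (hw ▸ w.2)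
  have hFfin : ∀ n, (F n).support.Finite := fun n => by
    refine ((hfin n).image Subtype.val).subset fun v hv => ?_
    have hvC : v ∈ C.supp := by
      by_contra h
      exact hv (hF0 n v h)
    exact ⟨⟨v, hvC⟩, fun h => hv ((hF n ⟨v, hvC⟩).trans h), rfl⟩
  have hmem : ∀ n, δ.linkFun ρ (F n) ∈ K.finSupp := fun n => δ.linkFun_mem_finSupp (hFfin n)
  have hsum : ∀ n, ∑' v : C.supp, (f n v : ℂ) * g v = inner ℂ
      (K.toHilbert ⟨_, (δ.finSupp_le_domainN (hmem n)).2⟩) (K.toHilbert b) := fun n => by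
    rw [← δ.inner_boundary (hmem n) b hb, ← (δ.hasSum_inner_linkFun _ _).tsum_eq]
    simp only [← hgb, ← hF]
    refine tsum_subtype_eq_of_support_subset (f := fun v => (F n v : ℂ) * g v) fun v hv => ?_
    by_contra h
    exact hv (by simp [hF0 n v h])
  have hlim1 : Tendsto (fun n => ∑' v : C.supp, (f n v : ℂ) * g v) atTop
      (𝓝 (∑' v : C.supp, g v)) := by
    refine tendsto_tsum_of_dominated_convergence (bound := fun v : C.supp => ‖g v‖)
      (hg.norm.subtype C.supp) (fun v => ?_) (Eventually.of_forall fun n v => ?_)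
    · have := ((Complex.continuous_ofReal.tendsto 1).comp (hlim v)).mul_const (g v)
      simpa using this
    · rw [norm_mul, Complex.norm_real, Real.norm_of_nonneg (h0 n v)]
      exact mul_le_of_le_one_left (norm_nonneg _) (h1 n v)
  refine tendsto_nhds_unique hlim1 ?_
  have hnorm : Tendsto (fun n => ‖K.toHilbert ⟨_, (δ.finSupp_le_domainN (hmem n)).2⟩‖) atTop
      (𝓝 0) := by
    have h2 : Tendsto (fun n => ENNReal.ofReal
        (‖K.toHilbert ⟨_, (δ.finSupp_le_domainN (hmem n)).2⟩‖ ^ 2)) atTop (𝓝 0) := by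
      refine tendsto_of_tendsto_of_tendsto_of_le_of_le tendsto_const_nhds hE
        (fun _ => zero_le) fun n => ?_
      change ENNReal.ofReal (‖K.toHilbert ⟨_, (δ.finSupp_le_domainN (hmem n)).2⟩‖ ^ 2) ≤ _
      rw [norm_toHilbert_sq]
      refine (δ.normSq_op_linkFun_le C (hF0 n)).trans_eq ?_
      simp only [hF]
    have h3 := ((ENNReal.tendsto_toReal (by simp)).comp h2).sqrt
    refine (h3.congr fun n => ?_).trans (by simp)
    simp
  simp only [hsum]
  refine squeeze_zero_norm (fun n => norm_inner_le_norm _ _) ?_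
  simpa using hnorm.mul_const ‖K.toHilbert b‖

theorem boundaryBoundaryNEqZero_of_recurrent
    (h : ∀ ρ : K.Simplex, (K.linkGraph ρ).AllComponentsRecurrent) :
    δ.BoundaryBoundaryNEqZero := by
  rw [boundaryBoundaryNEqZero_iff]
  intro b hb hη
  funext ρ
  have h1 := δ.hasSum_boundary (δ.l2_le_boundary_domain hη) ρ
  rw [← (linkCoface_injective ρ).hasSum_iff fun σ hσ => by
    rw [δ.θ_eq_zero fun h => hσ (exists_linkCoface h)]
    simp] at h1
  set g : K.Link ρ → ℂ := (fun σ => (K.m σ.1 : ℂ) * (δ.θ ρ σ *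
    δ.boundary ⟨b, δ.l2_le_boundary_domain hb⟩ σ)) ∘ linkCoface ρ with hgdef
  have h2 : ∑' v, g v = 0 := by
    -- The fibres of the component map are the component supports; absolute convergence permits
    -- regrouping along them.
    let e := Equiv.sigmaFiberEquiv (K.linkGraph ρ).toSimpleGraph.connectedComponentMk
    have hs := e.summable_iff.2 h1.summable
    rw [← e.tsum_eq g]
    refine (hs.tsum_sigma).trans ?_
    refine (tsum_congr fun C => ?_).trans tsum_zero
    exact δ.tsum_component_eq_zero C (h ρ C) ⟨b, hb⟩ hη h1.summable fun v => rfl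
  have h3 := h1.tsum_eq.symm.trans h2
  have : (K.m ρ.1 : ℂ) ≠ 0 := by exact_mod_cast (K.weight_pos ρ).ne'
  exact (mul_eq_zero.1 h3).resolve_left this

end Coboundary

end WeightedSimplicialComplex

end BoundaryComplex

end

theorem mainTheorem3 {X : Type*} [DecidableEq X]
    (K : BoundaryComplex.WeightedSimplicialComplex X) (δ : K.Coboundary) :
    (δ.IsIdealBoundaryCondition δ.opD ↔ δ.BoundaryBoundaryNEqZero) ∧
    ((∀ ρ : K.Simplex, (K.linkGraph ρ).AllComponentsRecurrent) →
      δ.IsIdealBoundaryCondition δ.opD) :=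
  ⟨δ.isIdealBoundaryCondition_opD_iff, fun h =>
    δ.isIdealBoundaryCondition_opD_iff.2 (δ.boundaryBoundaryNEqZero_of_recurrent h)⟩
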